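/- An \emph{ordered graph} is a structure $(V,<,\sim)$ where $<$ is a (strict) linear order on $V$ and $\sim$ is a symmetric irreflexive relation on $V$. An ordered tournament $(V,<,\to)$ is identified with the ordered graph in which, for $a<b$, $a\sim b$ holds if and only if $a\to b$; and a partial order $\lhd$ with a linear extension $<$ is identified with the ordered graph in which, for $a<b$, $a\sim b$ holds if and only if $a\lhd b$. A \emph{local order} is a tournament in which, for every vertex $x$, the set of predecessors of $x$ and the set of successors of $x$ are both linearly ordered by $\to$. The \emph{generic} member of a class of structures is the Fra\"iss\'e limit of the finite structures in the class. The \emph{complement} of $(V,<,\sim)$ has the same order and the complementary graph. Let $G$ be a countable ordered graph which is one of the following, or the complement of one of the following: \begin{itemize} \item the generic ordered linear order $(V,<,\to)$ (the tournament $\to$ is a linear order); \item the generic ordered local order $(V,<,\to)$ (the tournament $\to$ is a local order); \item the generic ordered graph; \item the generic ordered $K_n$-free graph, for some $n\ge 3$; \item the generic linear extension of the generic partial order, that is, the generic structure $(V,<,\lhd)$ with $\lhd$ a partial order and $<$ a linear extension of it; \item the empty graph $\vec I_\infty$ ordered in type $\mathbb Q$ (its complement is the complete graph $\vec K_\infty$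 ordered in type $\mathbb Q$); \item $\vec I_\infty[\vec K_\infty]$, obtained from $\vec I_\infty$ by substituting a copy of $\vec K_\infty$ for each point; \item a shuffled product $\vec I_n*\vec K_\infty$ for some $1\le n\le\infty$: distinct points are adjacent if and only if they lie in the same class of an equivalence relation with exactly $n$ classes (countably infinitely many if $n=\infty$), each class has order type $\mathbb Q$, and each class is dense in the whole order. \end{itemize} Let $\mathcal K_\omega(G)$ be the space of all structures with universe $\mathbb N$ that are isomorphic to a substructure of $G$. Then the isomorphism relation on $\mathcal K_\omega(G)$ is Borel complete. That is, $\mathcal K_\omega(G)$ is a Borel isomorphism-invariant set of structures with universe $\mathbb N$, and for every countable first-order language $L$ and every Borel isomorphism-invariant set $X$ of $L$-structures with universe $\mathbb N$, there is a Borel function $f\colon X\to\mathcal K_\omega(G)$ such that for all $x,x'\in X$, $x\cong x'$ if and only if $f(x)\cong f(x')$. -/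

import Mathlib

namespace OrderedGraphs

section BorelComplexity

/-- `E` is Borel reducible to `F`: some Borel map `f` satisfies `x E x' ↔ f x F f x'`. -/
def BorelReducible {X Y : Type} [MeasurableSpace X] [MeasurableSpace Y]
    (E : X → X → Prop) (F : Y → Y → Prop) : Prop :=
  ∃ f : X → Y, Measurable f ∧ ∀ x x' : X, E x x' ↔ F (f x) (f x')

/-- Two `L`-structures (with possibly different carriers) are isomorphic. -/
def Isomorphic {L : FirstOrder.Language.{0, 0}} {M N : Type}
    (S : L.Structure M) (T : L.Structure N) : Prop :=
  Nonempty (@FirstOrder.Language.Equiv L M N S T)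

/-- The structure `S` is isomorphic to a substructure of `T`. -/
def EmbedsIn {L : FirstOrder.Language.{0, 0}} {M N : Type}
    (S : L.Structure M) (T : L.Structure N) : Prop :=
  Nonempty (@FirstOrder.Language.Embedding L M N S T)

/-- The σ-algebra on the set of all `L`-structures with universe `ℕ` generated by the sets
`{S | f^S(x) = y}` and `{S | R^S(x)}`. For countable `L` these sets and their complements form a
countable subbasis of the usual Polish topology on the space of `L`-structures with universe `ℕ`,
so this is the Borel σ-algebra of that space. -/
instance structureMeasurableSpace (L : FirstOrder.Language.{0, 0}) : MeasurableSpace (L.Structure ℕ) :=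
  MeasurableSpace.generateFrom
    ({A | ∃ (n : ℕ) (f : L.Functions n) (x : Fin n → ℕ) (y : ℕ),
        A = {S : L.Structure ℕ | @FirstOrder.Language.Structure.funMap L ℕ S n f x = y}} ∪
      {A | ∃ (n : ℕ) (R : L.Relations n) (x : Fin n → ℕ),
        A = {S : L.Structure ℕ | @FirstOrder.Language.Structure.RelMap L ℕ S n R x}})

/-- A space of countable structures: a Borel, isomorphism-invariant set of `L`-structures with
universe `ℕ`. -/
structure IsStructureSpace {L : FirstOrder.Language.{0, 0}} (X : Set (L.Structure ℕ)) : Prop where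
  borel : MeasurableSet X
  invariant : ∀ S T : L.Structure ℕ, Isomorphic S T → S ∈ X → T ∈ X

/-- The isomorphism relation on a set of structures with universe `ℕ`. -/
def isoOn {L : FirstOrder.Language.{0, 0}} (X : Set (L.Structure ℕ)) (S T : X) : Prop :=
  Isomorphic S.1 T.1

/-- `Y` is a space of countable structures, and the isomorphism relation on every space `X` of
countable structures (in any countable language) is Borel reducible to the one on `Y`. -/
def BorelComplete {L : FirstOrder.Language.{0, 0}} (Y : Set (L.Structure ℕ)) : Prop :=
  IsStructureSpace Y ∧
    ∀ (L' : FirstOrder.Language.{0, 0}) [Countable L'.Symbols] (X : Set (L'.Structure ℕ)),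
      IsStructureSpace X → BorelReducible (isoOn X) (isoOn Y)

/-- The space of countable structures isomorphic to a substructure of `G`
(countably infinite ones, coded with universe `ℕ`). -/
def countableSubstructures {L : FirstOrder.Language.{0, 0}} {V : Type} (G : L.Structure V) :
    Set (L.Structure ℕ) :=
  {S | EmbedsIn S G}

end BorelComplexity

section OrderedGraphs

/-- The symbols of the language of ordered graphs: two binary relations. -/
inductive OrdGraphRel : ℕ → Type
  | lt : OrdGraphRel 2
  | adj : OrdGraphRel 2

/-- The language `{<, ∼}` of ordered graphs. -/
def ordGraph : FirstOrder.Language.{0, 0} where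
  Functions := fun _ => Empty
  Relations := OrdGraphRel

instance ordGraph_isEmpty_functions (n : ℕ) : IsEmpty (ordGraph.Functions n) :=
  inferInstanceAs (IsEmpty Empty)

variable {V : Type}

/-- `a < b` in the structure `S`. -/
def Lt (S : ordGraph.Structure V) (a b : V) : Prop :=
  @FirstOrder.Language.Structure.RelMap ordGraph V S 2 OrdGraphRel.lt ![a, b]

/-- `a ∼ b` in the structure `S`. -/
def Adj (S : ordGraph.Structure V) (a b : V) : Prop :=
  @FirstOrder.Language.Structure.RelMap ordGraph V S 2 OrdGraphRel.adj ![a, b]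

/-- The structure `(V, lt, adj)`. -/
@[reducible] def ordGraphOf (lt adj : V → V → Prop) : ordGraph.Structure V where
  funMap := fun f => isEmptyElim f
  RelMap := fun {n} (r : OrdGraphRel n) =>
    match n, r with
    | _, OrdGraphRel.lt => fun x => lt (x 0) (x 1)
    | _, OrdGraphRel.adj => fun x => adj (x 0) (x 1)

/-- `(V, <, ∼)` is an ordered graph: `<` is a (strict) linear order and `∼` is symmetric and
irreflexive. -/
structure IsOrderedGraph (S : ordGraph.Structure V) : Prop where
  linear : IsStrictTotalOrder V (Lt S)
  symm : ∀ a b : V, Adj S a b → Adj S b a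
  irrefl : ∀ a : V, ¬ Adj S a a

/-- The complementary ordered graph: same order, complementary graph. -/
@[reducible] def complement (S : ordGraph.Structure V) : ordGraph.Structure V :=
  ordGraphOf (Lt S) (fun a b => a ≠ b ∧ ¬ Adj S a b)

/-- The tournament `→` for which the ordered tournament `(V, <, →)` is identified with the ordered
graph `(V, <, ∼)`: for `a < b` one has `a ∼ b` exactly when `a → b`. -/
def Arrow (S : ordGraph.Structure V) (a b : V) : Prop :=
  (Lt S a b ∧ Adj S a b) ∨ (Lt S b a ∧ ¬ Adj S a b)

/-- The relation `◁` for which the linear extension `(V, <, ◁)` of a partial order is identified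
with the ordered graph `(V, <, ∼)`: for `a < b` one has `a ∼ b` exactly when `a ◁ b`. -/
def PartialLt (S : ordGraph.Structure V) (a b : V) : Prop :=
  Lt S a b ∧ Adj S a b

/-- An ordered linear order `(V, <, →)`, viewed as an ordered graph. -/
def IsOrderedLinearOrder (S : ordGraph.Structure V) : Prop :=
  IsOrderedGraph S ∧ IsStrictTotalOrder V (Arrow S)

/-- An ordered local order `(V, <, →)`, viewed as an ordered graph: for every vertex `x` of the
tournament, `→` linearly orders the predecessors of `x` and the successors of `x`. -/
def IsOrderedLocalOrder (S : ordGraph.Structure V) : Prop :=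
  IsOrderedGraph S ∧ ∀ x : V,
    IsStrictTotalOrder {y : V // Arrow S y x} (fun a b => Arrow S a.1 b.1) ∧
    IsStrictTotalOrder {y : V // Arrow S x y} (fun a b => Arrow S a.1 b.1)

/-- A `K_n`-free ordered graph. -/
def IsOrderedCliqueFree (n : ℕ) (S : ordGraph.Structure V) : Prop :=
  IsOrderedGraph S ∧ (SimpleGraph.fromRel (Adj S)).CliqueFree n

/-- A partial order `◁` with a linear extension `<`, viewed as an ordered graph. -/
def IsLinearExtension (S : ordGraph.Structure V) : Prop :=
  IsOrderedGraph S ∧ IsStrictOrder V (PartialLt S)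

/-- The class of finite structures with the property `P`. -/
def finiteClass (P : ∀ {W : Type}, ordGraph.Structure W → Prop) :
    Set (CategoryTheory.Bundled.{0} ordGraph.Structure) :=
  {N | Finite N ∧ P N.str}

/-- `S` is the generic structure with the property `P`: the Fraïssé limit of the class of finite
structures with property `P`, that is, the countable homogeneous structure whose finite
substructures are, up to isomorphism, exactly the members of that class. -/
def IsGeneric (P : ∀ {W : Type}, ordGraph.Structure W → Prop) [Countable V]
    (S : ordGraph.Structure V) : Prop :=
  @FirstOrder.Language.IsFraisseLimit ordGraph (finiteClass P) V S _ _

/-- The empty graph on `ℚ` with the usual order. -/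
@[reducible] def emptyQ : ordGraph.Structure ℚ :=
  ordGraphOf (fun a b => a < b) (fun _ _ => False)

/-- The empty graph ordered in type `ℚ`, with each point replaced by a complete graph ordered in
type `ℚ`. -/
@[reducible] def emptyOfComplete : ordGraph.Structure (ℚ × ℚ) :=
  ordGraphOf (Prod.Lex (fun a b => a < b) (fun a b => a < b)) (fun p q => p ≠ q ∧ p.1 = q.1)

/-- The shuffled product with classes indexed by `ι`: the graph `∼` is given by an equivalence
relation with classes indexed by `ι`, each class has order type `ℚ`, and each class is dense in the
whole order. -/
def IsShuffled (ι : Type) (S : ordGraph.Structure V) : Prop :=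
  IsOrderedGraph S ∧ ∃ c : V → ι,
    (∀ a b : V, Adj S a b ↔ a ≠ b ∧ c a = c b) ∧
    ∀ i : ι,
      Nonempty (RelIso (fun a b : {v : V // c v = i} => Lt S a.1 b.1)
        (fun p q : ℚ => p < q)) ∧
      ∀ a b : V, Lt S a b → ∃ d : V, c d = i ∧ Lt S a d ∧ Lt S d b

/-- The homogeneous ordered graphs in the classification, up to complementation. -/
inductive IsBasic [Countable V] (S : ordGraph.Structure V) : Prop
  | orderedLinearOrder : IsGeneric IsOrderedLinearOrder S → IsBasic S
  | orderedLocalOrder : IsGeneric IsOrderedLocalOrder S → IsBasic S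
  | orderedGraph : IsGeneric IsOrderedGraph S → IsBasic S
  | cliqueFree (n : ℕ) : 3 ≤ n → IsGeneric (IsOrderedCliqueFree n) S → IsBasic S
  | linearExtension : IsGeneric IsLinearExtension S → IsBasic S
  | empty : Isomorphic S emptyQ → IsBasic S
  | emptyOfComplete : Isomorphic S emptyOfComplete → IsBasic S
  | shuffledFinite (n : ℕ) : 1 ≤ n → IsShuffled (Fin n) S → IsBasic S
  | shuffledInfinite : IsShuffled ℕ S → IsBasic S

/-- The list of homogeneous ordered graphs: the basic ones and their complements. The complement of
the ordered empty graph is the ordered complete graph, and the complement of `emptyOfComplete` is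
the ordered complete graph with each point replaced by an ordered empty graph. -/
def InCherlinList [Countable V] (S : ordGraph.Structure V) : Prop :=
  ∃ T : ordGraph.Structure V, IsBasic T ∧ (S = T ∨ S = complement T)

end OrderedGraphs

end OrderedGraphs

/-!
Each of the classes `countableSubstructures G` contains all linear orders of `ℕ` with an empty
graph, or all of them with a complete graph. Hence the isomorphism relation on it is at least as
complex as isomorphism of countable linear orders, and the lower bound is the theorem of Friedman
and Stanley that linear orders are Borel complete (`exists_borel_linearOrder_of_structure`).

For this theorem, fix a countable linear order with a colouring by `ℕ` for which every colour is
dense (`RatTranslates`). Finite sequences of its points are ordered lexicographically, which makes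
them a dense order, and the colours of such a sequence form a tuple of elements of a structure `S`
with universe `ℕ`. Replacing each sequence by a finite block whose size codes the length of the
sequence and finitely much of the atomic type of the tuple gives a linear order attached to `S`. An
isomorphism of structures permutes the colours, so it lifts to an isomorphism of the linear orders
by Cantor's theorem for coloured orders (`IsShuffle.exists_orderIso`). Conversely, the blocks are
the maximal sets of points at finite distance from each other (`Blocks.node_eq_iff_finite`). An
isomorphism of the linear orders therefore induces an automorphism of the lexicographic order that
respects lengths and atomic types. The tree of sequences is definable from the order and the lengths
(`list_prefix_iff`), and going back and forth along a branch of it yields two enumerations that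
satisfy the same atomic formulas (`exists_enumerations`), hence an isomorphism of the structures.

The class `countableSubstructures G` is Borel because membership in it depends only on the finite
parts of a structure: a structure embeds into `G` as soon as all its finite parts do (`IsRich`). For
Fraïssé limits this is ultrahomogeneity. For the remaining graphs the finite parts determine
an equivalence relation, and embeddings are constructed from embeddings of countable linear orders
into `ℚ` and of coloured ones into shuffles. The property `IsRich` passes to complements.
-/

namespace OrderedGraphs

/-! ### Shuffles: dense colourings of linear orders -/

section Shuffles

variable {α β ι : Type}

/-- The colouring `c` of a linear order is a shuffle if every colour occurs between any two finite
sets, one of which precedes the other. As either set may be empty, the order has no endpoints and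
every colour class is dense in it. -/
def IsShuffle [LinearOrder α] (c : α → ι) : Prop :=
  ∀ (i : ι) (lo hi : Finset α), (∀ x ∈ lo, ∀ y ∈ hi, x < y) →
    ∃ m, c m = i ∧ (∀ x ∈ lo, x < m) ∧ ∀ y ∈ hi, m < y

theorem IsShuffle.of_dense [LinearOrder α] [Nonempty α] [Nonempty ι] [NoMinOrder α] [NoMaxOrder α]
    {c : α → ι} (h : ∀ i a b, a < b → ∃ x, c x = i ∧ a < x ∧ x < b) : IsShuffle c := by
  classical
  intro i lo hi hlo
  have : DenselyOrdered α := ⟨fun a b hab => by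
    obtain ⟨x, -, hx⟩ := h (Classical.arbitrary ι) a b hab
    exact ⟨x, hx⟩⟩
  obtain ⟨m, hm, hm'⟩ := Order.exists_between_finsets lo hi hlo
  obtain ⟨k, hk, hk'⟩ := Order.exists_between_finsets (insert m lo) hi (by
    intro x hx y hy
    rcases Finset.mem_insert.1 hx with rfl | hx
    · exact hm' y hy
    · exact hlo x hx y hy)
  obtain ⟨x, hx, hmx, hxk⟩ := h i m k (hk m (Finset.mem_insert_self _ _))
  exact ⟨x, hx, fun y hy => (hm y hy).trans hmx, fun y hy => hxk.trans (hk' y hy)⟩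

theorem IsShuffle.surjective [LinearOrder α] {c : α → ι} (h : IsShuffle c) :
    Function.Surjective c := fun i => by
  obtain ⟨m, hm, -⟩ := h i ∅ ∅ (by simp)
  exact ⟨m, hm⟩

/-- A finite set of pairs is a partial isomorphism of coloured orders if the pairs are ordered in
the same way by both coordinates and the colours of their coordinates agree. -/
def IsColouredPartialIso [LinearOrder α] [LinearOrder β] (d : α → ι) (c : β → ι)
    (f : Finset (α × β)) : Prop :=
  (∀ p ∈ f, ∀ q ∈ f, p.1 < q.1 ↔ p.2 < q.2) ∧ ∀ p ∈ f, d p.1 = c p.2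

section Extension

variable [LinearOrder α] [LinearOrder β] {d : α → ι} {c : β → ι}

theorem IsColouredPartialIso.exists_extension_left (hc : IsShuffle c) {f : Finset (α × β)}
    (hf : IsColouredPartialIso d c f) (a : α) :
    ∃ g, IsColouredPartialIso d c g ∧ f ⊆ g ∧ ∃ b, (a, b) ∈ g := by
  classical
  by_cases ha : ∃ b, (a, b) ∈ f
  · exact ⟨f, hf, subset_rfl, ha⟩
  obtain ⟨b, hb, hlo, hhi⟩ := hc (d a) ({p ∈ f | p.1 < a}.image Prod.snd)
    ({p ∈ f | a < p.1}.image Prod.snd) (by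
      simp only [Finset.mem_image, Finset.mem_filter]
      rintro x ⟨p, ⟨hp, hpa⟩, rfl⟩ y ⟨q, ⟨hq, hqa⟩, rfl⟩
      exact (hf.1 p hp q hq).1 (hpa.trans hqa))
  simp only [Finset.mem_image, Finset.mem_filter] at hlo hhi
  have key : ∀ p ∈ f, (p.1 < a ↔ p.2 < b) ∧ (a < p.1 ↔ b < p.2) := by
    intro p hp
    rcases lt_trichotomy p.1 a with h | h | h
    · have := hlo p.2 ⟨p, ⟨hp, h⟩, rfl⟩
      simp [h, this, h.not_gt, this.not_gt]
    · exact (ha ⟨p.2, h ▸ hp⟩).elim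
    · have := hhi p.2 ⟨p, ⟨hp, h⟩, rfl⟩
      simp [h, this, h.not_gt, this.not_gt]
  refine ⟨insert (a, b) f, ⟨?_, ?_⟩, Finset.subset_insert _ _, b, Finset.mem_insert_self _ _⟩
  · intro p hp q hq
    rcases Finset.mem_insert.1 hp with rfl | hp <;> rcases Finset.mem_insert.1 hq with rfl | hq
    · simp
    · exact (key q hq).2
    · exact (key p hp).1
    · exact hf.1 p hp q hq
  · intro p hp
    rcases Finset.mem_insert.1 hp with rfl | hp
    · exact hb.symm
    · exact hf.2 p hp

theorem IsColouredPartialIso.swap [DecidableEq α] [DecidableEq β] {f : Finset (α × β)}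
    (hf : IsColouredPartialIso d c f) :
    IsColouredPartialIso c d (f.image Prod.swap) := by
  simp only [IsColouredPartialIso, Finset.mem_image]
  refine ⟨?_, ?_⟩
  · rintro _ ⟨p, hp, rfl⟩ _ ⟨q, hq, rfl⟩
    exact (hf.1 p hp q hq).symm
  · rintro _ ⟨p, hp, rfl⟩
    exact (hf.2 p hp).symm

theorem IsColouredPartialIso.exists_extension_right (hd : IsShuffle d) {f : Finset (α × β)}
    (hf : IsColouredPartialIso d c f) (b : β) :
    ∃ g, IsColouredPartialIso d c g ∧ f ⊆ g ∧ ∃ a, (a, b) ∈ g := by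
  classical
  obtain ⟨g, hg, hfg, a, ha⟩ := hf.swap.exists_extension_left hd b
  refine ⟨g.image Prod.swap, hg.swap, fun p hp => ?_, a, Finset.mem_image.2 ⟨_, ha, rfl⟩⟩
  exact Finset.mem_image.2 ⟨p.swap, hfg (Finset.mem_image_of_mem _ hp), p.swap_swap⟩

variable (d c) in
/-- The finite partial isomorphisms of coloured orders, ordered by inclusion. -/
abbrev ColouredPartialIso := {f : Finset (α × β) // IsColouredPartialIso d c f}

variable (d c) in
theorem isColouredPartialIso_empty : IsColouredPartialIso d c (∅ : Finset (α × β)) := by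
  simp [IsColouredPartialIso]

/-- The partial isomorphisms defined at `a`. -/
def ColouredPartialIso.definedAtLeft (d : α → ι) (hc : IsShuffle c) (a : α) :
    Order.Cofinal (ColouredPartialIso d c) where
  carrier := {f | ∃ b, (a, b) ∈ f.1}
  isCofinal f := by
    obtain ⟨g, hg, hfg, hb⟩ := f.2.exists_extension_left hc a
    exact ⟨⟨g, hg⟩, hb, hfg⟩

/-- The partial isomorphisms with `b` in their range. -/
def ColouredPartialIso.definedAtRight (c : β → ι) (hd : IsShuffle d) (b : β) :
    Order.Cofinal (ColouredPartialIso d c) where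
  carrier := {f | ∃ a, (a, b) ∈ f.1}
  isCofinal f := by
    obtain ⟨g, hg, hfg, hb⟩ := f.2.exists_extension_right hd b
    exact ⟨⟨g, hg⟩, hb, hfg⟩

end Extension

/-- Every countable coloured linear order embeds into every shuffle of the same colours. -/
theorem IsShuffle.exists_orderEmbedding [LinearOrder α] [LinearOrder β] [Countable α]
    {c : β → ι} (hc : IsShuffle c) (d : α → ι) :
    ∃ f : α ↪o β, ∀ a, c (f a) = d a := by
  cases nonempty_encodable α
  let D := ColouredPartialIso.definedAtLeft d hc
  let I := Order.idealOfCofinals (⟨∅, isColouredPartialIso_empty d c⟩ : ColouredPartialIso d c) D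
  have hI : ∀ a : α, ∃ b : β, ∃ f ∈ I, (a, b) ∈ f.1 := fun a => by
    obtain ⟨f, ⟨b, hb⟩, hf⟩ := Order.cofinal_meets_idealOfCofinals _ D a
    exact ⟨b, f, hf, hb⟩
  choose F f hfI hF using hI
  refine ⟨OrderEmbedding.ofStrictMono F fun a a' haa' => ?_, fun a => ((f a).2.2 _ (hF a)).symm⟩
  obtain ⟨g, -, hg, hg'⟩ := I.directed _ (hfI a) _ (hfI a')
  exact (g.2.1 _ (hg (hF a)) _ (hg' (hF a'))).1 haa'

/-- Cantor's theorem for coloured orders: two countable shuffles of the same colours are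
isomorphic. -/
theorem IsShuffle.exists_orderIso [LinearOrder α] [LinearOrder β] [Countable α] [Countable β]
    {d : α → ι} {c : β → ι} (hd : IsShuffle d) (hc : IsShuffle c) :
    ∃ f : α ≃o β, ∀ a, c (f a) = d a := by
  cases nonempty_encodable α
  cases nonempty_encodable β
  let D : α ⊕ β → Order.Cofinal (ColouredPartialIso d c) :=
    Sum.elim (ColouredPartialIso.definedAtLeft d hc) (ColouredPartialIso.definedAtRight c hd)
  let I := Order.idealOfCofinals (⟨∅, isColouredPartialIso_empty d c⟩ : ColouredPartialIso d c) D
  have hl : ∀ a : α, ∃ b : β, ∃ f ∈ I, (a, b) ∈ f.1 := fun a => by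
    obtain ⟨f, ⟨b, hb⟩, hf⟩ := Order.cofinal_meets_idealOfCofinals _ D (Sum.inl a)
    exact ⟨b, f, hf, hb⟩
  have hr : ∀ b : β, ∃ a : α, ∃ f ∈ I, (a, b) ∈ f.1 := fun b => by
    obtain ⟨f, ⟨a, ha⟩, hf⟩ := Order.cofinal_meets_idealOfCofinals _ D (Sum.inr b)
    exact ⟨a, f, hf, ha⟩
  choose F f hfI hF using hl
  have mono : ∀ a b a' b', (∃ f ∈ I, (a, b) ∈ f.1) → (∃ f ∈ I, (a', b') ∈ f.1) →
      (a < a' ↔ b < b') := by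
    rintro a b a' b' ⟨f, hf, hab⟩ ⟨f', hf', hab'⟩
    obtain ⟨g, -, hg, hg'⟩ := I.directed _ hf _ hf'
    exact g.2.1 _ (hg hab) _ (hg' hab')
  have hsm : StrictMono F := fun a a' h =>
    (mono a _ a' _ ⟨_, hfI a, hF a⟩ ⟨_, hfI a', hF a'⟩).1 h
  refine ⟨hsm.orderIsoOfSurjective F fun b => ?_, fun a => ((f a).2.2 _ (hF a)).symm⟩
  obtain ⟨a, hab⟩ := hr b
  have h₁ := mono a _ a _ ⟨_, hfI a, hF a⟩ hab
  have h₂ := mono a _ a _ hab ⟨_, hfI a, hF a⟩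
  simp only [lt_irrefl, false_iff, not_lt] at h₁ h₂
  exact ⟨a, le_antisymm h₂ h₁⟩

/-- The union of the disjoint translates `ℚ + k√2` of `ℚ`, for `k : ℕ`, as a suborder of `ℝ`. -/
def RatTranslates : Type := ℚ × ℕ

namespace RatTranslates

/-- The real number `q + k√2`. -/
noncomputable def toReal (x : RatTranslates) : ℝ := x.1 + x.2 * √2

theorem toReal_injective : Function.Injective toReal := by
  rintro ⟨q, k⟩ ⟨r, l⟩ h
  simp only [toReal] at h
  have hkl : k = l := by
    by_contra hne
    have hne' : (k : ℚ) - l ≠ 0 := sub_ne_zero.2 (by exact_mod_cast hne)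
    have hne'' : (k : ℝ) - l ≠ 0 := by exact_mod_cast hne'
    refine irrational_sqrt_two ⟨(r - q) / (k - l), ?_⟩
    push_cast
    rw [div_eq_iff hne'']
    linear_combination -h
  subst hkl
  have : q = r := by simpa using h
  rw [this]

noncomputable instance : LinearOrder RatTranslates := LinearOrder.lift' toReal toReal_injective

instance : Countable RatTranslates := inferInstanceAs (Countable (ℚ × ℕ))

instance : Nonempty RatTranslates := ⟨((0, 0) : ℚ × ℕ)⟩

/-- The translate containing a given point. -/
def colour (x : RatTranslates) : ℕ := x.2

theorem exists_between_of_colour (i : ℕ) {s t : ℝ} (h : s < t) :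
    ∃ x : RatTranslates, x.colour = i ∧ s < x.toReal ∧ x.toReal < t := by
  obtain ⟨q, hq, hq'⟩ := exists_rat_btwn (sub_lt_sub_right h (i * √2))
  exact ⟨((q, i) : ℚ × ℕ), rfl, sub_lt_iff_lt_add.1 hq, lt_sub_iff_add_lt.1 hq'⟩

instance : NoMinOrder RatTranslates := ⟨fun a => by
  obtain ⟨x, -, -, hx⟩ := exists_between_of_colour 0 (sub_one_lt a.toReal)
  exact ⟨x, hx⟩⟩

instance : NoMaxOrder RatTranslates := ⟨fun a => by
  obtain ⟨x, -, hx, -⟩ := exists_between_of_colour 0 (lt_add_one a.toReal)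
  exact ⟨x, hx⟩⟩

theorem isShuffle_colour : IsShuffle colour :=
  .of_dense fun i _ _ h => exists_between_of_colour i h

end RatTranslates

end Shuffles

/-! ### The lexicographic tree of finite sequences -/

section Tree

variable {O : Type} [LinearOrder O]

theorem list_lt_append_singleton (u : List O) (a : O) : u < u ++ [a] := by
  induction u with
  | nil => simp
  | cons b u ih => exact List.cons_lt_cons_iff.2 (Or.inr ⟨rfl, ih⟩)

instance list_denselyOrdered [NoMinOrder O] : DenselyOrdered (List O) := ⟨by
  intro u
  induction u with
  | nil =>
    rintro (_ | ⟨b, v⟩) h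
    · exact (lt_irrefl _ h).elim
    · obtain ⟨a, ha⟩ := exists_lt b
      exact ⟨[a], by simp, List.cons_lt_cons_iff.2 (Or.inl ha)⟩
  | cons a u ih =>
    rintro (_ | ⟨b, v⟩) h
    · simp at h
    · rcases List.cons_lt_cons_iff.1 h with hab | ⟨rfl, huv⟩
      · exact ⟨a :: u ++ [a], list_lt_append_singleton _ _, List.cons_lt_cons_iff.2 (Or.inl hab)⟩
      · obtain ⟨w, huw, hwv⟩ := ih v huv
        exact ⟨a :: w, List.cons_lt_cons_iff.2 (Or.inr ⟨rfl, huw⟩),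
          List.cons_lt_cons_iff.2 (Or.inr ⟨rfl, hwv⟩)⟩⟩

/-- The tree order on finite sequences is definable from the lexicographic order and the lengths:
the extensions of `u` are the sequences that can be reached from `u` going up without meeting a
sequence that is at most as long as `u`. -/
theorem list_prefix_iff (u v : List O) :
    u <+: v ↔ ¬ v < u ∧ ∀ w, u < w → ¬ v < w → u.length < w.length := by
  induction u generalizing v with
  | nil =>
    refine ⟨fun _ => ⟨by simp, ?_⟩, fun _ => List.nil_prefix⟩
    rintro (_ | ⟨b, w⟩) h -
    · exact (lt_irrefl _ h).elim
    · simp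
  | cons a u ih =>
    rcases v with _ | ⟨b, v⟩
    · simp
    rw [List.cons_prefix_cons, ih]
    rcases lt_trichotomy a b with hab | rfl | hab
    · refine iff_of_false (fun h => hab.ne h.1) fun h => ?_
      have := h.2 [b] (List.cons_lt_cons_iff.2 (Or.inl hab)) (by simp)
      simp at this
    · simp only [List.cons_lt_cons_iff, lt_irrefl, false_or, true_and]
      refine and_congr_right fun _ => ⟨fun h w huw hvw => ?_, fun h w huw hvw => ?_⟩
      · rcases w with _ | ⟨d, w⟩
        · simp at huw
        simp only [List.cons_lt_cons_iff] at huw hvw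
        rcases huw with hlt | ⟨rfl, huw⟩
        · exact (hvw (Or.inl hlt)).elim
        · simpa using h w huw (fun h' => hvw (Or.inr ⟨rfl, h'⟩))
      · simpa using h (a :: w) (List.cons_lt_cons_iff.2 (Or.inr ⟨rfl, huw⟩))
          (by simpa [List.cons_lt_cons_iff] using hvw)
    · exact iff_of_false (fun h => hab.ne' h.1)
        fun h => h.1 (List.cons_lt_cons_iff.2 (Or.inl hab))

theorem exists_map_append_singleton (φ : List O ≃o List O) (hφ : ∀ u, (φ u).length = u.length)
    (u : List O) (q : O) : ∃ r, φ (u ++ [q]) = φ u ++ [r] := by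
  have h : φ u <+: φ (u ++ [q]) := by
    have h₀ : u <+: u ++ [q] := List.prefix_append _ _
    rw [list_prefix_iff] at h₀ ⊢
    refine ⟨by simpa using h₀.1, fun w huw hvw => ?_⟩
    obtain ⟨w, rfl⟩ := φ.surjective w
    simpa [hφ] using h₀.2 w (by simpa using huw) (by simpa using hvw)
  obtain ⟨t, ht⟩ := h
  have hl : t.length = 1 := by
    have := congrArg List.length ht
    simp only [List.length_append, hφ, List.length_singleton] at this
    omega
  obtain ⟨r, rfl⟩ := List.length_eq_one_iff.1 hl
  exact ⟨r, ht.symm⟩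

theorem exists_append_singleton_map (φ : List O ≃o List O) (hφ : ∀ u, (φ u).length = u.length)
    (u : List O) (r : O) : ∃ q, φ (u ++ [q]) = φ u ++ [r] := by
  obtain ⟨q, hq⟩ := exists_map_append_singleton φ.symm
    (fun u => by rw [← hφ, OrderIso.apply_symm_apply]) (φ u) r
  refine ⟨q, ?_⟩
  rw [OrderIso.symm_apply_apply] at hq
  rw [← hq, OrderIso.apply_symm_apply]

/-- A back-and-forth argument along a branch of the tree. An automorphism of the tree that respects
codes attached to the colour sequences yields two enumerations all of whose initial segments have
the same codes. -/
theorem exists_enumerations {C : Type} {c : O → ℕ} (hc : Function.Surjective c)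
    (φ : List O ≃o List O) (hφ : ∀ u, (φ u).length = u.length) (k k' : List ℕ → C)
    (h : ∀ u, k (u.map c) = k' ((φ u).map c)) :
    ∃ a b : ℕ → ℕ, Function.Surjective a ∧ Function.Surjective b ∧
      ∀ n, k ((List.range n).map a) = k' ((List.range n).map b) := by
  -- The even steps put `n / 2` into the first enumeration, the odd steps into the second.
  have step : ∀ n u, ∃ q r, φ (u ++ [q]) = φ u ++ [r] ∧
      (n % 2 = 0 → c q = n / 2) ∧ (n % 2 = 1 → c r = n / 2) := by
    intro n u
    obtain ⟨x, hx⟩ := hc (n / 2)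
    rcases Nat.mod_two_eq_zero_or_one n with hn | hn
    · obtain ⟨r, hr⟩ := exists_map_append_singleton φ hφ u x
      exact ⟨x, r, hr, fun _ => hx, by omega⟩
    · obtain ⟨q, hq⟩ := exists_append_singleton_map φ hφ u x
      exact ⟨q, x, hq, by omega, fun _ => hx⟩
  choose q r hqr heven hodd using step
  let U : ℕ → List O := fun n => Nat.rec [] (fun n u => u ++ [q n u]) n
  have hU : ∀ n, U (n + 1) = U n ++ [q n (U n)] := fun _ => rfl
  refine ⟨fun n => c (q n (U n)), fun n => c (r n (U n)), fun m => ⟨2 * m, ?_⟩,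
    fun m => ⟨2 * m + 1, ?_⟩, fun n => ?_⟩
  · exact (heven _ _ (by omega)).trans (by omega)
  · exact (hodd _ _ (by omega)).trans (by omega)
  · have h₁ : (U n).map c = (List.range n).map fun n => c (q n (U n)) := by
      induction n with
      | zero => rfl
      | succ n ih => rw [hU, List.map_append, ih, List.range_succ, List.map_append]; rfl
    have h₂ : (φ (U n)).map c = (List.range n).map fun n => c (r n (U n)) := by
      clear h₁
      induction n with
      | zero => exact List.length_eq_zero_iff.1 (by rw [List.length_map, hφ]; rfl)
      | succ n ih => rw [hU, hqr, List.map_append, ih, List.range_succ, List.map_append]; rfl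
    rw [← h₁, ← h₂, h]

end Tree

/-! ### Replacing the points of a dense order by finite blocks -/

section Blocks

variable {A B : Type}

/-- The linear order obtained from `A` by replacing each point `a` by a chain of `N a + 1`
points. -/
abbrev Blocks (N : A → ℕ) : Type := {p : A ×ₗ ℕ // (ofLex p).2 ≤ N (ofLex p).1}

namespace Blocks

variable {N : A → ℕ} {N' : B → ℕ}

/-- The point of `A` whose block contains `p`. -/
def node (p : Blocks N) : A := (ofLex p.1).1

/-- The least element of the block of `a`. -/
def bot (N : A → ℕ) (a : A) : Blocks N := ⟨toLex (a, 0), Nat.zero_le _⟩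

theorem node_bot (a : A) : (bot N a).node = a := rfl

theorem finite_node_eq (a : A) : {p : Blocks N | p.node = a}.Finite := by
  refine ((Set.finite_Iic (N a)).image fun i => toLex (a, i)).preimage
    Subtype.val_injective.injOn |>.subset ?_
  rintro ⟨p, hp⟩ rfl
  exact ⟨(ofLex p).2, hp, rfl⟩

theorem card_node_eq (a : A) : Nat.card {p : Blocks N // p.node = a} = N a + 1 := by
  have e : {p : Blocks N // p.node = a} ≃ Fin (N a + 1) :=
    { toFun := fun p => ⟨(ofLex p.1.1).2, Nat.lt_succ_of_le (p.1.2.trans (congrArg N p.2).le)⟩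
      invFun := fun i => ⟨⟨toLex (a, i), Nat.le_of_lt_succ i.2⟩, rfl⟩
      left_inv := by rintro ⟨⟨p, hp⟩, rfl⟩; rfl
      right_inv := fun _ => rfl }
  simpa using Nat.card_congr e

variable [LinearOrder A] [LinearOrder B]

theorem lt_iff {p q : Blocks N} :
    p < q ↔ p.node < q.node ∨ p.node = q.node ∧ (ofLex p.1).2 < (ofLex q.1).2 :=
  Prod.Lex.lt_iff

theorem lt_of_node_lt {p q : Blocks N} (h : p.node < q.node) : p < q := lt_iff.2 (Or.inl h)

theorem node_mono : Monotone (node : Blocks N → A) := fun _ _ h =>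
  le_of_not_gt fun h' => (lt_of_node_lt h').not_ge h

/-- Two points of a block order lie in the same block if and only if there are only finitely many
points between them. -/
theorem node_eq_iff_finite [DenselyOrdered A] {p q : Blocks N} (hpq : p ≤ q) :
    p.node = q.node ↔ (Set.Icc p q).Finite := by
  refine ⟨fun h => (finite_node_eq p.node).subset fun x hx => ?_, fun h => ?_⟩
  · exact le_antisymm ((node_mono hx.2).trans h.ge) (node_mono hx.1)
  · by_contra hne
    have hlt : p.node < q.node := lt_of_le_of_ne (node_mono hpq) hne
    refine (Set.Ioo_infinite hlt) ((h.image node).subset fun w hw => ⟨bot N w, ⟨?_, ?_⟩, rfl⟩)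
    · exact (lt_of_node_lt hw.1).le
    · exact (lt_of_node_lt hw.2).le

theorem node_map_eq_iff [DenselyOrdered A] [DenselyOrdered B] (F : Blocks N ≃o Blocks N')
    (p q : Blocks N) : (F p).node = (F q).node ↔ p.node = q.node := by
  wlog hpq : p ≤ q generalizing p q
  · rw [eq_comm, this q p (le_of_not_ge hpq), eq_comm]
  rw [node_eq_iff_finite hpq, node_eq_iff_finite (F.monotone hpq), ← F.image_Icc,
    Set.finite_image_iff F.injective.injOn]

/-- An isomorphism of block orders over dense orders is induced by an isomorphism of these dense
orders that respects the sizes of the blocks. -/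
theorem exists_orderIso [DenselyOrdered A] [DenselyOrdered B] (F : Blocks N ≃o Blocks N') :
    ∃ φ : A ≃o B, ∀ a, N' (φ a) = N a := by
  have hmono : StrictMono fun a => (F (bot N a)).node := fun a b hab =>
    lt_of_le_of_ne (node_mono (F.monotone (lt_of_node_lt (p := bot N a) (q := bot N b) hab).le))
      fun h => hab.ne ((node_map_eq_iff F _ _).1 h)
  have hnode : ∀ p, (F p).node = (F (bot N p.node)).node := fun p =>
    (node_map_eq_iff F _ _).2 rfl
  refine ⟨hmono.orderIsoOfSurjective _ fun b => ⟨(F.symm (bot N' b)).node, ?_⟩, fun a => ?_⟩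
  · change (F (bot N _)).node = b
    rw [← hnode, OrderIso.apply_symm_apply, node_bot]
  · change N' (F (bot N a)).node = N a
    have := Nat.card_congr (F.toEquiv.subtypeEquiv
      (p := fun p => p.node = a) (q := fun p => p.node = (F (bot N a)).node) fun p => by
        change _ ↔ (F p).node = _
        rw [node_map_eq_iff, node_bot])
    rw [card_node_eq, card_node_eq] at this
    omega

theorem orderIso_of_orderIso (φ : A ≃o B) (hφ : ∀ a, N' (φ a) = N a) :
    Nonempty (Blocks N ≃o Blocks N') := by
  have hmono : StrictMono fun p : Blocks N =>
      (⟨toLex (φ p.node, (ofLex p.1).2), (p.2.trans (hφ _).ge :)⟩ : Blocks N') := by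
    intro p q h
    rw [lt_iff] at h ⊢
    exact h.imp (fun h => φ.strictMono h) fun h => ⟨congrArg φ h.1, h.2⟩
  refine ⟨hmono.orderIsoOfSurjective _ fun (p : Blocks N') => ?_⟩
  refine ⟨⟨toLex (φ.symm (node p), (ofLex p.1).2), ?_⟩, ?_⟩
  · change (ofLex p.1).2 ≤ N (φ.symm (node p))
    rw [← hφ, OrderIso.apply_symm_apply]
    exact p.2
  · apply Subtype.ext
    change toLex (φ (φ.symm (node p)), (ofLex p.1).2) = p.1
    rw [OrderIso.apply_symm_apply]
    rfl

end Blocks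

end Blocks

/-! ### Coding the atomic diagram of a structure -/

section AtomicFormulas

open FirstOrder.Language.Structure (funMap RelMap)

variable {L : FirstOrder.Language.{0, 0}}

/-- The bijection `e` between the carriers is an isomorphism of structures. -/
structure IsIsomorphism {M N : Type} (S : L.Structure M) (T : L.Structure N) (e : M ≃ N) :
    Prop where
  map_fun : ∀ (n : ℕ) (f : L.Functions n) (x : Fin n → M), e (funMap f x) = funMap f (e ∘ x)
  map_rel : ∀ (n : ℕ) (R : L.Relations n) (x : Fin n → M), RelMap R (e ∘ x) ↔ RelMap R x

theorem isomorphic_iff {M N : Type} {S : L.Structure M} {T : L.Structure N} :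
    Isomorphic S T ↔ ∃ e : M ≃ N, IsIsomorphism S T e :=
  ⟨fun ⟨e⟩ => ⟨e.toEquiv, fun _ => e.map_fun', fun _ => e.map_rel'⟩,
    fun ⟨e, hf, hR⟩ => ⟨⟨e, hf _, hR _⟩⟩⟩

variable (L) in
/-- The unnested atomic formulas in the variables `v₀, v₁, …`: the formulas `R(v_{x 0}, …)`, the
formulas `f(v_{x 0}, …) = v_j`, and the formulas `v_i = v_j`. -/
abbrev AtomicFormula : Type :=
  (Σ n, L.Relations n × (Fin n → ℕ)) ⊕ (Σ n, L.Functions n × (Fin n → ℕ) × ℕ) ⊕ (ℕ × ℕ)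

instance [Countable L.Symbols] : Countable (AtomicFormula L) := by
  have hR : Countable (Σ n, L.Relations n) :=
    (Sum.inr_injective (α := Σ n, L.Functions n)).countable
  have hF : Countable (Σ n, L.Functions n) :=
    (Sum.inl_injective (β := Σ n, L.Relations n)).countable
  have (n : ℕ) : Countable (L.Relations n) :=
    (sigma_mk_injective (β := fun n => L.Relations n) (i := n)).countable
  have (n : ℕ) : Countable (L.Functions n) :=
    (sigma_mk_injective (β := fun n => L.Functions n) (i := n)).countable
  infer_instance

namespace AtomicFormula

/-- Satisfaction of an unnested atomic formula under the assignment `v`. -/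
def Holds {M : Type} (S : L.Structure M) (v : ℕ → M) : AtomicFormula L → Prop
  | .inl ⟨_, R, x⟩ => RelMap R (v ∘ x)
  | .inr (.inl ⟨_, f, x, j⟩) => funMap f (v ∘ x) = v j
  | .inr (.inr (i, j)) => v i = v j

/-- A number greater than the indices of all variables of the formula. -/
def bound : AtomicFormula L → ℕ
  | .inl ⟨_, _, x⟩ => Finset.univ.sup x + 1
  | .inr (.inl ⟨_, _, x, j⟩) => max (Finset.univ.sup x) j + 1
  | .inr (.inr (i, j)) => max i j + 1

theorem holds_congr {M : Type} (S : L.Structure M) {v w : ℕ → M} :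
    ∀ (q : AtomicFormula L), (∀ i < bound q, v i = w i) → (Holds S v q ↔ Holds S w q)
  | .inl ⟨_, R, x⟩, h => by
    have hx : v ∘ x = w ∘ x := funext fun i =>
      h _ (Nat.lt_succ_of_le (Finset.le_sup (Finset.mem_univ i)))
    simp only [Holds, hx]
  | .inr (.inl ⟨_, f, x, j⟩), h => by
    have hx : v ∘ x = w ∘ x := funext fun i =>
      h _ (Nat.lt_succ_of_le ((Finset.le_sup (Finset.mem_univ i)).trans (le_max_left _ _)))
    simp only [Holds, hx, h j (Nat.lt_succ_of_le (le_max_right _ _))]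
  | .inr (.inr (i, j)), h => by
    simp only [Holds, h i (Nat.lt_succ_of_le (le_max_left _ _)),
      h j (Nat.lt_succ_of_le (le_max_right _ _))]

theorem holds_comp {M N : Type} {S : L.Structure M} {T : L.Structure N} {e : M ≃ N}
    (he : IsIsomorphism S T e) (v : ℕ → M) : ∀ q : AtomicFormula L, Holds T (e ∘ v) q ↔ Holds S v q
  | .inl ⟨_, R, x⟩ => he.map_rel _ R (v ∘ x)
  | .inr (.inl ⟨_, f, x, j⟩) => by
    simp only [Holds, Function.comp_assoc, ← he.map_fun, Function.comp_apply, e.apply_eq_iff_eq]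
  | .inr (.inr (i, j)) => e.apply_eq_iff_eq

/-- Two enumerations satisfying the same atomic formulas induce an isomorphism. -/
theorem isomorphic_of_holds_iff {M N : Type} {S : L.Structure M} {T : L.Structure N}
    {a : ℕ → M} {b : ℕ → N} (ha : Function.Surjective a) (hb : Function.Surjective b)
    (h : ∀ q : AtomicFormula L, Holds S a q ↔ Holds T b q) : Isomorphic S T := by
  have heq : ∀ i j, a i = a j ↔ b i = b j := fun i j => h (.inr (.inr (i, j)))
  choose s hs using ha
  choose t ht using hb
  let e : M ≃ N :=
    { toFun := fun x => b (s x)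
      invFun := fun y => a (t y)
      left_inv := fun x => by rw [← hs x, heq, ht, hs]
      right_inv := fun y => by rw [← ht y, ← heq, hs, ht] }
  have he : ∀ i, e (a i) = b i := fun i => (heq _ _).1 (hs _)
  have hlift : ∀ {n : ℕ} (x : Fin n → M), ∃ y : Fin n → ℕ, x = a ∘ y ∧ e ∘ x = b ∘ y :=
    fun x => ⟨s ∘ x, funext fun i => (hs _).symm, rfl⟩
  refine isomorphic_iff.2 ⟨e, fun n f x => ?_, fun n R x => ?_⟩
  · obtain ⟨y, rfl, hy⟩ := hlift x
    have hval : funMap f (a ∘ y) = a (s (funMap f (a ∘ y))) := (hs _).symm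
    rw [hy, hval, he]
    exact ((h (.inr (.inl ⟨n, f, y, s (funMap f (a ∘ y))⟩))).1 hval).symm
  · obtain ⟨y, rfl, hy⟩ := hlift x
    rw [hy]
    exact (h (.inl ⟨n, R, y⟩)).symm

theorem measurableSet_holds (v : ℕ → ℕ) :
    ∀ q : AtomicFormula L, MeasurableSet {S : L.Structure ℕ | Holds S v q}
  | .inl ⟨n, R, x⟩ => MeasurableSpace.measurableSet_generateFrom (Or.inr ⟨n, R, v ∘ x, rfl⟩)
  | .inr (.inl ⟨n, f, x, j⟩) =>
    MeasurableSpace.measurableSet_generateFrom (Or.inl ⟨n, f, v ∘ x, v j, rfl⟩)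
  | .inr (.inr (i, j)) => .const (v i = v j)

open Classical in
/-- Given an enumeration `E` of the atomic formulas, the set of those `k` less than the length
of `l` for which `E k` involves only variables whose index is less than this length and holds under
the assignment `l`. -/
noncomputable def typeCode (E : ℕ → AtomicFormula L) (S : L.Structure ℕ) (l : List ℕ) : Finset ℕ :=
  {k ∈ Finset.range l.length | bound (E k) ≤ l.length ∧ Holds S (fun i => l.getD i 0) (E k)}

theorem typeCode_map {E : ℕ → AtomicFormula L} {S T : L.Structure ℕ} {e : ℕ ≃ ℕ}
    (he : IsIsomorphism S T e) (l : List ℕ) : typeCode E T (l.map e) = typeCode E S l := by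
  ext k
  simp only [typeCode, Finset.mem_filter, List.length_map]
  refine and_congr_right fun _ => and_congr_right fun hb => ?_
  rw [← holds_comp he fun i => l.getD i 0]
  refine holds_congr T _ fun i hi => ?_
  have hi' : i < l.length := hi.trans_le hb
  simp [List.getD_eq_getElem?_getD, List.getElem?_map, List.getElem?_eq_getElem hi']

theorem holds_iff_of_typeCode_eq {E : ℕ → AtomicFormula L} (hE : Function.Surjective E)
    {S T : L.Structure ℕ} {a b : ℕ → ℕ}
    (h : ∀ n, typeCode E S ((List.range n).map a) = typeCode E T ((List.range n).map b))
    (q : AtomicFormula L) : Holds S a q ↔ Holds T b q := by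
  obtain ⟨k, rfl⟩ := hE q
  have hmem : ∀ (S : L.Structure ℕ) (a : ℕ → ℕ),
      k ∈ typeCode E S ((List.range (max (k + 1) (bound (E k)))).map a) ↔ Holds S a (E k) := by
    intro S a
    have hk : k < max (k + 1) (bound (E k)) := lt_max_of_lt_left k.lt_succ_self
    simp only [typeCode, Finset.mem_filter, List.length_map, List.length_range, Finset.mem_range,
      hk, le_max_right, true_and]
    refine holds_congr S _ fun i hi => ?_
    have hi' : i < max (k + 1) (bound (E k)) := lt_max_of_lt_right hi
    simp [List.getD_eq_getElem?_getD, List.getElem?_map, List.getElem?_range hi']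
  rw [← hmem, ← hmem, h]

theorem measurableSet_typeCode (E : ℕ → AtomicFormula L) (l : List ℕ) (P : Finset ℕ → Prop) :
    MeasurableSet {S : L.Structure ℕ | P (typeCode E S l)} := by
  have hmem : ∀ k, MeasurableSet {S : L.Structure ℕ | k ∈ typeCode E S l} := fun k => by
    simp only [typeCode, Finset.mem_filter]
    exact .inter (.const _) (.inter (.const _) (measurableSet_holds _ _))
  have : {S : L.Structure ℕ | P (typeCode E S l)} =
      ⋃ s : {s : Finset ℕ // P s}, ⋂ k, {S : L.Structure ℕ | k ∈ typeCode E S l ↔ k ∈ s.1} := by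
    ext S
    simp only [Set.mem_ofPred_eq, Set.mem_iUnion, Set.mem_iInter, ← Finset.ext_iff]
    exact ⟨fun h => ⟨⟨_, h⟩, rfl⟩, fun ⟨s, hs⟩ => hs ▸ s.2⟩
  rw [this]
  exact .iUnion fun s => .iInter fun k => (hmem k).iff (.const _)

end AtomicFormula

end AtomicFormulas

/-! ### Linear orders are Borel complete -/

section FriedmanStanley

/-- The enumeration of a Borel family of infinite sets of numbers is Borel, as `Nat.nth p k = m`
says that `m` is in the set and has exactly `k` predecessors there. -/
theorem measurableSet_nth {Ω : Type} [MeasurableSpace Ω] {p : Ω → ℕ → Prop}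
    (hp : ∀ k, MeasurableSet {x | p x k}) (hinf : ∀ x, {k | p x k}.Infinite) (k m : ℕ) :
    MeasurableSet {x | Nat.nth (p x) k = m} := by
  classical
  have hcount : ∀ m j, MeasurableSet {x | Nat.count (p x) m = j} := by
    intro m
    induction m with
    | zero => simp
    | succ m ih =>
      intro j
      have : {x | Nat.count (p x) (m + 1) = j} =
          ({x | p x m} ∩ {x | Nat.count (p x) m + 1 = j}) ∪
            ({x | p x m}ᶜ ∩ {x | Nat.count (p x) m = j}) := by
        ext x
        by_cases h : p x m <;> simp [Nat.count_succ, h]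
      rw [this]
      refine .union (.inter (hp m) ?_) (.inter (hp m).compl (ih j))
      cases j with
      | zero => simp
      | succ j => simpa using ih j
  have : {x | Nat.nth (p x) k = m} = {x | p x m} ∩ {x | Nat.count (p x) m = k} := by
    ext x
    constructor
    · rintro rfl
      exact ⟨Nat.nth_mem_of_infinite (hinf x) k, Nat.count_nth_of_infinite (hinf x) k⟩
    · rintro ⟨h, rfl⟩
      exact Nat.nth_count h
  rw [this]
  exact (hp m).inter (hcount m k)

/-- A copy on `ℕ` of the block order with block sizes `N` can be found in a Borel way from `N`. -/
theorem exists_measurable_blocks {Ω A : Type} [MeasurableSpace Ω] [LinearOrder A] [Countable A]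
    [Infinite A] (N : Ω → A → ℕ) (hN : ∀ a i, MeasurableSet {x | i ≤ N x a}) :
    ∃ r : Ω → ℕ → ℕ → Prop, (∀ i j, MeasurableSet {x | r x i j}) ∧
      ∀ x, Nonempty (r x ≃r ((· < ·) : Blocks (N x) → Blocks (N x) → Prop)) := by
  obtain ⟨e⟩ : Nonempty (ℕ ≃ A × ℕ) := nonempty_equiv_of_countable
  let p : Ω → ℕ → Prop := fun x k => (e k).2 ≤ N x (e k).1
  have hp : ∀ k, MeasurableSet {x | p x k} := fun k => hN _ _
  have hinf : ∀ x, {k | p x k}.Infinite := fun x => by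
    refine Set.infinite_of_injective_forall_mem (f := fun a => e.symm (a, 0)) ?_ fun a => ?_
    · exact fun a b h => congrArg Prod.fst (e.symm.injective h)
    · simp [p]
  refine ⟨fun x i j => toLex (e (Nat.nth (p x) i)) < toLex (e (Nat.nth (p x) j)),
    fun i j => ?_, fun x => ?_⟩
  · have : {x | toLex (e (Nat.nth (p x) i)) < toLex (e (Nat.nth (p x) j))} =
        ⋃ (k : ℕ) (l : ℕ) (_ : toLex (e k) < toLex (e l)),
          {x | Nat.nth (p x) i = k} ∩ {x | Nat.nth (p x) j = l} := by
      ext x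
      simp only [Set.mem_ofPred_eq, Set.mem_iUnion, Set.mem_inter_iff]
      exact ⟨fun h => ⟨_, _, h, rfl, rfl⟩, fun ⟨_, _, h, hk, hl⟩ => by rwa [hk, hl]⟩
    rw [this]
    exact .iUnion fun k => .iUnion fun l => .iUnion fun _ =>
      (measurableSet_nth hp hinf i k).inter (measurableSet_nth hp hinf j l)
  · let F : ℕ → Blocks (N x) := fun k =>
      ⟨toLex (e (Nat.nth (p x) k)), Nat.nth_mem_of_infinite (hinf x) k⟩
    have hF : Function.Bijective F := by
      constructor
      · intro i j h
        exact Nat.nth_injective (hinf x) (e.injective (toLex.injective (congrArg Subtype.val h)))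
      · rintro ⟨q, hq⟩
        have hq' : p x (e.symm (ofLex q)) := by simpa [p] using hq
        obtain ⟨k, hk⟩ : e.symm (ofLex q) ∈ Set.range (Nat.nth (p x)) := by
          rw [Nat.range_nth_of_infinite (hinf x)]
          exact hq'
        refine ⟨k, Subtype.ext ?_⟩
        change toLex (e (Nat.nth (p x) k)) = q
        rw [hk, e.apply_symm_apply]
        rfl
    exact ⟨⟨Equiv.ofBijective F hF, Iff.rfl⟩⟩

open AtomicFormula in
/-- **Friedman–Stanley theorem**. For every countable language there is a Borel map from the
structures with universe `ℕ` to the linear orders of `ℕ` that preserves and reflects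
isomorphism. -/
theorem exists_borel_linearOrder_of_structure (L : FirstOrder.Language.{0, 0})
    [Countable L.Symbols] :
    ∃ r : L.Structure ℕ → ℕ → ℕ → Prop, (∀ i j, MeasurableSet {S | r S i j}) ∧
      (∀ S, IsStrictTotalOrder ℕ (r S)) ∧
      ∀ S T, Isomorphic S T ↔ Nonempty (r S ≃r r T) := by
  have : Nonempty (AtomicFormula L) := ⟨.inr (.inr (0, 0))⟩
  obtain ⟨E, hE⟩ := exists_surjective_nat (AtomicFormula L)
  let c := RatTranslates.colour
  let N : L.Structure ℕ → List RatTranslates → ℕ := fun S u =>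
    Encodable.encode (u.length, typeCode E S (u.map c))
  have hN : ∀ u i, MeasurableSet {S | i ≤ N S u} := fun u i =>
    measurableSet_typeCode E (u.map c) fun s => i ≤ Encodable.encode (u.length, s)
  obtain ⟨r, hr, hrN⟩ := exists_measurable_blocks N hN
  refine ⟨r, hr, fun S => ?_, fun S T => ?_⟩
  · obtain ⟨e⟩ := hrN S
    exact e.toRelEmbedding.isStrictTotalOrder
  obtain ⟨eS⟩ := hrN S
  obtain ⟨eT⟩ := hrN T
  constructor
  · intro h
    obtain ⟨g, hg⟩ := isomorphic_iff.1 h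
    -- Recolouring by the permutation `g` gives another shuffle of the same colours.
    have hshuffle : IsShuffle (g ∘ c) := fun i lo hi hlo => by
      obtain ⟨m, hm, hm'⟩ := RatTranslates.isShuffle_colour (g.symm i) lo hi hlo
      exact ⟨m, by simp [c, hm], hm'⟩
    obtain ⟨h, hh⟩ := hshuffle.exists_orderIso RatTranslates.isShuffle_colour
    have hmono : StrictMono (List.map h) := fun u v huv =>
      List.map_lt (fun x y hxy => h.strictMono hxy) huv
    let φ : List RatTranslates ≃o List RatTranslates :=
      hmono.orderIsoOfSurjective _ h.surjective.list_map
    obtain ⟨F⟩ := Blocks.orderIso_of_orderIso (N := N S) (N' := N T) φ fun u => by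
      have : ((u.map h).map c) = (u.map c).map g := by
        rw [List.map_map, List.map_map]
        exact List.map_congr_left fun x _ => hh x
      change Encodable.encode ((u.map h).length, typeCode E T ((u.map h).map c)) = _
      rw [this, typeCode_map hg, List.length_map]
    exact ⟨(eS.trans F.toRelIsoLT).trans eT.symm⟩
  · rintro ⟨F⟩
    obtain ⟨φ, hφ⟩ := Blocks.exists_orderIso (N := N S) (N' := N T)
      (OrderIso.ofRelIsoLT ((eS.symm.trans F).trans eT))
    have hcode : ∀ u, (φ u).length = u.length ∧
        typeCode E T ((φ u).map c) = typeCode E S (u.map c) := fun u =>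
      Prod.ext_iff.1 (Encodable.encode_injective (hφ u))
    obtain ⟨a, b, ha, hb, hab⟩ := exists_enumerations RatTranslates.isShuffle_colour.surjective φ
      (fun u => (hcode u).1) (typeCode E S) (typeCode E T) fun u => (hcode u).2.symm
    exact isomorphic_of_holds_iff ha hb (holds_iff_of_typeCode_eq hE hab)

end FriedmanStanley

section OrderedGraphEmbeddings

open FirstOrder.Language.Structure (RelMap)

/-! ### Embeddings of ordered graphs -/

variable {U V W : Type}

instance : ordGraph.IsRelational := ordGraph_isEmpty_functions

/-- The map `f` is an embedding of `S` into `T`. -/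
structure IsEmbedding (S : ordGraph.Structure V) (T : ordGraph.Structure W) (f : V → W) : Prop where
  injective : Function.Injective f
  lt_iff : ∀ a b, Lt S a b ↔ Lt T (f a) (f b)
  adj_iff : ∀ a b, Adj S a b ↔ Adj T (f a) (f b)

theorem eta_fin_two (x : Fin 2 → V) : x = ![x 0, x 1] := by
  ext i
  fin_cases i <;> rfl

theorem relMap_lt_iff {S : ordGraph.Structure V} (x : Fin 2 → V) :
    RelMap (L := ordGraph) OrdGraphRel.lt x ↔ Lt S (x 0) (x 1) := by
  rw [Lt, ← eta_fin_two x]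

theorem relMap_adj_iff {S : ordGraph.Structure V} (x : Fin 2 → V) :
    RelMap (L := ordGraph) OrdGraphRel.adj x ↔ Adj S (x 0) (x 1) := by
  rw [Adj, ← eta_fin_two x]

theorem relMap_comp_iff {S : ordGraph.Structure V} {T : ordGraph.Structure W} {f : V → W}
    (hlt : ∀ a b, Lt S a b ↔ Lt T (f a) (f b)) (hadj : ∀ a b, Adj S a b ↔ Adj T (f a) (f b))
    {n : ℕ} (R : ordGraph.Relations n) (x : Fin n → V) : RelMap R (f ∘ x) ↔ RelMap R x := by
  cases R with
  | lt => exact (relMap_lt_iff _).trans ((hlt _ _).symm.trans (relMap_lt_iff _).symm)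
  | adj => exact (relMap_adj_iff _).trans ((hadj _ _).symm.trans (relMap_adj_iff _).symm)

theorem IsEmbedding.comp {R : ordGraph.Structure U} {S : ordGraph.Structure V}
    {T : ordGraph.Structure W} {f : V → W} {g : U → V} (hf : IsEmbedding S T f)
    (hg : IsEmbedding R S g) : IsEmbedding R T (f ∘ g) :=
  ⟨hf.injective.comp hg.injective, fun a b => (hg.lt_iff a b).trans (hf.lt_iff _ _),
    fun a b => (hg.adj_iff a b).trans (hf.adj_iff _ _)⟩

theorem isEmbedding_coe {S : ordGraph.Structure V} {T : ordGraph.Structure W}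
    (f : FirstOrder.Language.Embedding ordGraph V W) : IsEmbedding S T f :=
  ⟨f.injective,
    fun a b => (f.map_rel' (n := 2) OrdGraphRel.lt ![a, b]).symm.trans (relMap_lt_iff _),
    fun a b => (f.map_rel' (n := 2) OrdGraphRel.adj ![a, b]).symm.trans (relMap_adj_iff _)⟩

theorem embedsIn_iff {S : ordGraph.Structure V} {T : ordGraph.Structure W} :
    EmbedsIn S T ↔ ∃ f, IsEmbedding S T f :=
  ⟨fun ⟨f⟩ => ⟨f, isEmbedding_coe f⟩, fun ⟨f, hf⟩ =>
    ⟨⟨⟨f, hf.injective⟩, fun f => isEmptyElim f, relMap_comp_iff hf.lt_iff hf.adj_iff⟩⟩⟩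

theorem exists_isEmbedding_of_isomorphic {S : ordGraph.Structure V} {T : ordGraph.Structure W}
    (h : Isomorphic S T) : ∃ f, IsEmbedding S T f := by
  obtain ⟨e⟩ := h
  exact ⟨_, isEmbedding_coe e.toEmbedding⟩

theorem isomorphic_symm {L : FirstOrder.Language.{0, 0}} {S : L.Structure V} {T : L.Structure W}
    (h : Isomorphic S T) : Isomorphic T S :=
  h.map fun e => e.symm

/-- If every bijection preserves adjacency, then the ordered graphs are isomorphic if and only if
their orders are. -/
theorem isomorphic_ordGraphOf_iff {r adj : V → V → Prop} {s adj' : W → W → Prop}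
    (hadj : ∀ (e : V ≃ W) a b, adj a b ↔ adj' (e a) (e b)) :
    Isomorphic (ordGraphOf r adj) (ordGraphOf s adj') ↔ Nonempty (r ≃r s) := by
  let := ordGraphOf r adj
  let : ordGraph.Structure W := ordGraphOf s adj'
  constructor
  · rintro ⟨e⟩
    exact ⟨⟨e.toEquiv, ((isEmbedding_coe e.toEmbedding).lt_iff _ _).symm⟩⟩
  · rintro ⟨e⟩
    exact ⟨⟨e.toEquiv, fun f => isEmptyElim f, relMap_comp_iff (f := e)
      (S := ordGraphOf r adj) (T := ordGraphOf s adj')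
      (fun _ _ => e.map_rel_iff.symm) (fun _ _ => hadj e.toEquiv _ _)⟩⟩

theorem measurableSet_lt (i j : ℕ) : MeasurableSet {S : ordGraph.Structure ℕ | Lt S i j} :=
  MeasurableSpace.measurableSet_generateFrom (Or.inr ⟨2, OrdGraphRel.lt, ![i, j], rfl⟩)

theorem measurableSet_adj (i j : ℕ) : MeasurableSet {S : ordGraph.Structure ℕ | Adj S i j} :=
  MeasurableSpace.measurableSet_generateFrom (Or.inr ⟨2, OrdGraphRel.adj, ![i, j], rfl⟩)

theorem measurable_ordGraphOf {Ω : Type} [MeasurableSpace Ω] {r : Ω → ℕ → ℕ → Prop}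
    (hr : ∀ i j, MeasurableSet {x | r x i j}) (adj : ℕ → ℕ → Prop) :
    Measurable fun x => ordGraphOf (r x) adj := by
  refine measurable_generateFrom ?_
  rintro _ (⟨n, f, x, y, rfl⟩ | ⟨n, R, x, rfl⟩)
  · exact isEmptyElim f
  · cases R with
    | lt => exact hr (x 0) (x 1)
    | adj => exact .const (adj (x 0) (x 1))

/-! ### Classes determined by finite substructures -/

/-- Every finite part of the structure `S` with universe `ℕ` embeds into `G`. -/
def LocallyEmbedsIn (S : ordGraph.Structure ℕ) (G : ordGraph.Structure V) : Prop :=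
  ∀ n : ℕ, ∃ f : Fin n → V, ∀ i j : Fin n, (f i = f j → i = j) ∧
    (Lt S i j ↔ Lt G (f i) (f j)) ∧ (Adj S i j ↔ Adj G (f i) (f j))

theorem IsEmbedding.locallyEmbedsIn {S : ordGraph.Structure ℕ} {G : ordGraph.Structure V}
    {f : ℕ → V} (hf : IsEmbedding S G f) : LocallyEmbedsIn S G := fun _ =>
  ⟨fun i => f i, fun _ _ =>
    ⟨fun h => Fin.ext (hf.injective h), hf.lt_iff _ _, hf.adj_iff _ _⟩⟩

theorem measurableSet_locallyEmbedsIn [Countable V] (G : ordGraph.Structure V) :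
    MeasurableSet {S : ordGraph.Structure ℕ | LocallyEmbedsIn S G} := by
  simp only [LocallyEmbedsIn, Set.ofPred_forall, Set.ofPred_exists, Set.ofPred_and]
  exact .iInter fun n => .iUnion fun f => .iInter fun i => .iInter fun j =>
    .inter (.iInter fun _ => .const _) (.inter ((measurableSet_lt i j).iff (.const _))
      ((measurableSet_adj i j).iff (.const _)))

/-- Adjacency in `G` is irreflexive, and the class of countable structures embedding into `G` is
determined by the finite substructures of its members and contains all linear orders with an empty
graph, or all linear orders with a complete graph. -/
structure IsRich (G : ordGraph.Structure V) : Prop where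
  irrefl : ∀ a, ¬ Adj G a a
  embedsIn_of_locally : ∀ S : ordGraph.Structure ℕ, LocallyEmbedsIn S G → EmbedsIn S G
  orders : (∀ r : ℕ → ℕ → Prop, IsStrictTotalOrder ℕ r →
      EmbedsIn (ordGraphOf r fun _ _ => False) G) ∨
    ∀ r : ℕ → ℕ → Prop, IsStrictTotalOrder ℕ r → EmbedsIn (ordGraphOf r fun a b => a ≠ b) G

theorem IsRich.of_isomorphic {G : ordGraph.Structure V} {H : ordGraph.Structure W}
    (hH : IsRich H) (h : Isomorphic G H) : IsRich G := by
  obtain ⟨f, hf⟩ := exists_isEmbedding_of_isomorphic h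
  obtain ⟨g, hg⟩ := exists_isEmbedding_of_isomorphic (isomorphic_symm h)
  have key : ∀ S : ordGraph.Structure ℕ, EmbedsIn S H → EmbedsIn S G := fun S hS => by
    obtain ⟨k, hk⟩ := embedsIn_iff.1 hS
    exact embedsIn_iff.2 ⟨_, hg.comp hk⟩
  refine ⟨fun a => (hf.adj_iff a a).not.2 (hH.irrefl _), fun S hS => ?_,
    hH.orders.imp (fun h r hr => key _ (h r hr)) fun h r hr => key _ (h r hr)⟩
  refine key S (hH.embedsIn_of_locally S fun n => ?_)
  obtain ⟨k, hk⟩ := hS n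
  exact ⟨f ∘ k, fun i j => ⟨fun h => (hk i j).1 (hf.injective h),
    (hk i j).2.1.trans (hf.lt_iff _ _), (hk i j).2.2.trans (hf.adj_iff _ _)⟩⟩

theorem isEmbedding_complement_iff {S : ordGraph.Structure V} {T : ordGraph.Structure W}
    (hT : ∀ a, ¬ Adj T a a) {f : V → W} :
    IsEmbedding S (complement T) f ↔ (∀ a, ¬ Adj S a a) ∧ IsEmbedding (complement S) T f := by
  constructor
  · intro h
    have hadj : ∀ a b, Adj S a b ↔ f a ≠ f b ∧ ¬ Adj T (f a) (f b) := h.adj_iff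
    refine ⟨fun a ha => ((hadj a a).1 ha).1 rfl, h.injective, h.lt_iff, fun a b => ?_⟩
    change a ≠ b ∧ ¬ Adj S a b ↔ _
    rw [hadj, ← h.injective.ne_iff]
    refine ⟨fun h => by_contra fun h' => h.2 ⟨h.1, h'⟩, fun h => ⟨fun hab => ?_, fun h' => h'.2 h⟩⟩
    exact hT _ (hab ▸ h)
  · rintro ⟨hS, h⟩
    have hadj : ∀ a b, (a ≠ b ∧ ¬ Adj S a b) ↔ Adj T (f a) (f b) := h.adj_iff
    refine ⟨h.injective, h.lt_iff, fun a b => ?_⟩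
    change _ ↔ f a ≠ f b ∧ ¬ Adj T (f a) (f b)
    rw [← hadj, h.injective.ne_iff]
    refine ⟨fun h => ⟨fun hab => hS _ (hab ▸ h), fun h' => h'.2 h⟩, fun h => ?_⟩
    exact by_contra fun h' => h.2 ⟨h.1, h'⟩

theorem IsRich.complement {G : ordGraph.Structure V} (hG : IsRich G) :
    IsRich (complement G) := by
  have key : ∀ S : ordGraph.Structure ℕ, (∀ a, ¬ Adj S a a) →
      EmbedsIn (OrderedGraphs.complement S) G → EmbedsIn S (OrderedGraphs.complement G) := by
    intro S hS h
    obtain ⟨f, hf⟩ := embedsIn_iff.1 h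
    exact embedsIn_iff.2 ⟨f, (isEmbedding_complement_iff hG.irrefl).2 ⟨hS, hf⟩⟩
  refine ⟨fun a h => h.1 rfl, fun S hS => ?_, hG.orders.symm.imp ?_ ?_⟩
  · have hirr : ∀ a, ¬ Adj S a a := fun a h => by
      obtain ⟨f, hf⟩ := hS (a + 1)
      exact ((hf (Fin.last a) (Fin.last a)).2.2.1 h).1 rfl
    refine key S hirr (hG.embedsIn_of_locally _ fun n => ?_)
    obtain ⟨f, hf⟩ := hS n
    refine ⟨f, fun i j => ⟨(hf i j).1, (hf i j).2.1, ?_⟩⟩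
    change (i : ℕ) ≠ j ∧ ¬ Adj S i j ↔ _
    have hij : (i : ℕ) ≠ j ↔ f i ≠ f j :=
      not_congr ⟨fun h => congrArg f (Fin.ext h), fun h => congrArg Fin.val ((hf i j).1 h)⟩
    rw [(hf i j).2.2, hij]
    change f i ≠ f j ∧ ¬ (f i ≠ f j ∧ ¬ Adj G (f i) (f j)) ↔ _
    refine ⟨fun h => by_contra fun h' => h.2 ⟨h.1, h'⟩, fun h => ⟨fun hab => ?_, fun h' => h'.2 h⟩⟩
    exact hG.irrefl _ (hab ▸ h)
  · intro h r hr
    refine key _ (fun _ h => h) ?_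
    have : OrderedGraphs.complement (ordGraphOf r fun _ _ => False) =
        ordGraphOf r fun a b => a ≠ b := by
      change ordGraphOf r (fun a b => a ≠ b ∧ ¬ False) = _
      simp
    exact this ▸ h r hr
  · intro h r hr
    refine key _ (fun _ h => h rfl) ?_
    have : OrderedGraphs.complement (ordGraphOf r fun a b => a ≠ b) =
        ordGraphOf r fun _ _ => False := by
      change ordGraphOf r (fun a b => a ≠ b ∧ ¬ a ≠ b) = _
      simp
    exact this ▸ h r hr

theorem IsRich.borelComplete [Countable V] {G : ordGraph.Structure V} (hG : IsRich G) :
    BorelComplete (countableSubstructures G) := by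
  refine ⟨⟨?_, ?_⟩, fun L _ X _ => ?_⟩
  · have : countableSubstructures G = {S | LocallyEmbedsIn S G} := by
      ext S
      refine ⟨fun h => ?_, hG.embedsIn_of_locally S⟩
      obtain ⟨f, hf⟩ := embedsIn_iff.1 h
      exact hf.locallyEmbedsIn
    rw [this]
    exact measurableSet_locallyEmbedsIn G
  · intro S T hST hS
    obtain ⟨f, hf⟩ := embedsIn_iff.1 hS
    obtain ⟨g, hg⟩ := exists_isEmbedding_of_isomorphic (isomorphic_symm hST)
    exact embedsIn_iff.2 ⟨_, hf.comp hg⟩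
  · obtain ⟨r, hr, hlin, hiso⟩ := exists_borel_linearOrder_of_structure L
    have key : ∀ adj : ℕ → ℕ → Prop, (∀ (e : ℕ ≃ ℕ) a b, adj a b ↔ adj (e a) (e b)) →
        (∀ r : ℕ → ℕ → Prop, IsStrictTotalOrder ℕ r → EmbedsIn (ordGraphOf r adj) G) →
        BorelReducible (isoOn X) (isoOn (countableSubstructures G)) := fun adj hadj h =>
      ⟨fun S => ⟨ordGraphOf (r S) adj, h _ (hlin S)⟩,
        ((measurable_ordGraphOf hr adj).comp measurable_subtype_coe).subtype_mk,
        fun S T => (hiso S T).trans (isomorphic_ordGraphOf_iff hadj).symm⟩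
    rcases hG.orders with h | h
    · exact key _ (fun _ _ _ => Iff.rfl) h
    · exact key _ (fun e _ _ => e.injective.ne_iff.symm) h

end OrderedGraphEmbeddings

section RichOrderedGraphs

variable {V : Type}

/-! ### Fraïssé limits -/

section Generic

variable [Countable V] {P : ∀ {W : Type}, ordGraph.Structure W → Prop} {G : ordGraph.Structure V}

theorem IsGeneric.prop_iff (hG : IsGeneric P G) {W : Type} [Finite W] (S : ordGraph.Structure W) :
    P S ↔ EmbedsIn S G := by
  have h : (⟨W, S⟩ : CategoryTheory.Bundled ordGraph.Structure) ∈
      @FirstOrder.Language.age ordGraph V G ↔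
      (⟨W, S⟩ : CategoryTheory.Bundled ordGraph.Structure) ∈ finiteClass P := by
    rw [hG.age]
  have hFG : @FirstOrder.Language.Structure.FG ordGraph W S :=
    FirstOrder.Language.Structure.fg_iff_finite.2 inferInstance
  exact ⟨fun hP => (h.2 ⟨inferInstance, hP⟩).2, fun hS => (h.1 ⟨hFG, hS⟩).2⟩

/-- Ultrahomogeneity turns embeddings of the finite parts of a countable structure into an embedding
of the whole structure. -/
theorem IsGeneric.embedsIn_of_locally (hG : IsGeneric P G) {S : ordGraph.Structure ℕ}
    (hS : LocallyEmbedsIn S G) : EmbedsIn S G := by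
  let := S
  let := G
  have hext : ordGraph.IsExtensionPair ℕ V := by
    rw [FirstOrder.Language.isExtensionPair_iff_exists_embedding_closure_singleton_sup]
    intro A hA f m
    have hB : (FirstOrder.Language.Substructure.closure ordGraph {m} ⊔ A).FG :=
      (FirstOrder.Language.Substructure.fg_closure_singleton m).sup hA
    have hfin := FirstOrder.Language.Substructure.fg_iff_finite.1 hB
    obtain ⟨n, hn⟩ := (Set.toFinite
      ((FirstOrder.Language.Substructure.closure ordGraph {m} ⊔ A :
        ordGraph.Substructure ℕ) : Set ℕ)).bddAbove
    obtain ⟨k, hk⟩ := hS (n + 1)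
    let i : (FirstOrder.Language.Substructure.closure ordGraph {m} ⊔ A :
      ordGraph.Substructure ℕ) → Fin (n + 1) := fun b => ⟨b, Nat.lt_succ_of_le (hn b.2)⟩
    have hB' := isEmbedding_coe (FirstOrder.Language.Substructure.subtype
      (FirstOrder.Language.Substructure.closure ordGraph {m} ⊔ A))
    have hemb : EmbedsIn (FirstOrder.Language.Substructure.inducedStructure) G :=
      embedsIn_iff.2 ⟨k ∘ i, fun a b hab => Subtype.ext (Fin.mk.inj ((hk _ _).1 hab)),
        fun a b => (hB'.lt_iff a b).trans (hk (i a) (i b)).2.1,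
        fun a b => (hB'.adj_iff a b).trans (hk (i a) (i b)).2.2⟩
    exact FirstOrder.Language.IsUltrahomogeneous.extend_embedding hG.ultrahomogeneous
      ((FirstOrder.Language.Substructure.fg_iff_structure_fg _).1 hA) (h := hemb) f
      (FirstOrder.Language.Substructure.inclusion le_sup_right)
  have : IsEmpty ordGraph.Constants := ordGraph_isEmpty_functions 0
  have : IsEmpty (ordGraph.Relations 0) := ⟨fun R => by cases R⟩
  obtain ⟨f, -⟩ := FirstOrder.Language.embedding_from_cg
    (FirstOrder.Language.Structure.cg_iff_countable.2 inferInstance) default hext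
  exact ⟨f⟩

theorem IsGeneric.embedsIn_ordGraphOf (hG : IsGeneric P G) {adj : ∀ {W : Type}, W → W → Prop}
    (hadj : ∀ n (i j : Fin n), adj i j ↔ adj (i : ℕ) (j : ℕ))
    (hP : ∀ {W : Type} (r : W → W → Prop), IsStrictTotalOrder W r → P (ordGraphOf r adj))
    (r : ℕ → ℕ → Prop) (hr : IsStrictTotalOrder ℕ r) : EmbedsIn (ordGraphOf r adj) G := by
  refine hG.embedsIn_of_locally fun n => ?_
  let s : Fin n → Fin n → Prop := fun i j => r i j
  have hs : IsStrictTotalOrder (Fin n) s :=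
    (⟨⟨Fin.val, Fin.val_injective⟩, Iff.rfl⟩ : s ↪r r).isStrictTotalOrder
  obtain ⟨f, hf⟩ := embedsIn_iff.1 ((hG.prop_iff (ordGraphOf s adj)).1 (hP s hs))
  exact ⟨f, fun i j => ⟨fun h => hf.injective h, hf.lt_iff i j,
    (hadj n i j).symm.trans (hf.adj_iff i j)⟩⟩

theorem IsGeneric.irrefl (hG : IsGeneric P G)
    (hP : ∀ {W : Type} (S : ordGraph.Structure W), P S → IsOrderedGraph S) (a : V) :
    ¬ Adj G a a := by
  let S : ordGraph.Structure Unit := ordGraphOf (fun _ _ => Lt G a a) fun _ _ => Adj G a a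
  have hS : EmbedsIn S G := embedsIn_iff.2
    ⟨fun _ => a, fun _ _ _ => rfl, fun _ _ => Iff.rfl, fun _ _ => Iff.rfl⟩
  exact (hP S ((hG.prop_iff S).2 hS)).irrefl ()

theorem IsGeneric.isRich_of_empty (hG : IsGeneric P G)
    (hP : ∀ {W : Type} (S : ordGraph.Structure W), P S → IsOrderedGraph S)
    (h : ∀ {W : Type} (r : W → W → Prop), IsStrictTotalOrder W r →
      P (ordGraphOf r fun _ _ => False)) : IsRich G :=
  ⟨hG.irrefl hP, fun _ => hG.embedsIn_of_locally,
    Or.inl (hG.embedsIn_ordGraphOf (adj := fun _ _ => False) (fun _ _ _ => Iff.rfl) h)⟩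

theorem IsGeneric.isRich_of_complete (hG : IsGeneric P G)
    (hP : ∀ {W : Type} (S : ordGraph.Structure W), P S → IsOrderedGraph S)
    (h : ∀ {W : Type} (r : W → W → Prop), IsStrictTotalOrder W r →
      P (ordGraphOf r fun a b => a ≠ b)) : IsRich G :=
  ⟨hG.irrefl hP, fun _ => hG.embedsIn_of_locally,
    Or.inr (hG.embedsIn_ordGraphOf (adj := fun a b => a ≠ b)
      (fun _ _ _ => Fin.val_injective.ne_iff.symm) h)⟩

end Generic

theorem isOrderedGraph_empty (r : V → V → Prop) (hr : IsStrictTotalOrder V r) :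
    IsOrderedGraph (ordGraphOf r fun _ _ => False) :=
  ⟨hr, fun _ _ h => h, fun _ h => h⟩

theorem isOrderedGraph_complete (r : V → V → Prop) (hr : IsStrictTotalOrder V r) :
    IsOrderedGraph (ordGraphOf r fun a b => a ≠ b) :=
  ⟨hr, fun _ _ h => Ne.symm h, fun _ h => h rfl⟩

theorem arrow_complete (r : V → V → Prop) (hr : IsStrictTotalOrder V r) :
    Arrow (ordGraphOf r fun a b => a ≠ b) = r := by
  funext a b
  change ((r a b ∧ a ≠ b) ∨ (r b a ∧ ¬ a ≠ b)) = r a b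
  refine propext ⟨?_, fun h => Or.inl ⟨h, ?_⟩⟩
  · rintro (h | ⟨h, hab⟩)
    · exact h.1
    · obtain rfl := not_not.1 hab
      exact h
  · rintro rfl
    exact irrefl_of r a h

theorem isOrderedLinearOrder_complete (r : V → V → Prop) (hr : IsStrictTotalOrder V r) :
    IsOrderedLinearOrder (ordGraphOf r fun a b => a ≠ b) :=
  ⟨isOrderedGraph_complete r hr, by rwa [arrow_complete r hr]⟩

theorem isOrderedLocalOrder_complete (r : V → V → Prop) (hr : IsStrictTotalOrder V r) :
    IsOrderedLocalOrder (ordGraphOf r fun a b => a ≠ b) := by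
  refine ⟨isOrderedGraph_complete r hr, ?_⟩
  rw [arrow_complete r hr]
  exact fun x => ⟨(Subrel.relEmbedding r {y | r y x}).isStrictTotalOrder,
    (Subrel.relEmbedding r {y | r x y}).isStrictTotalOrder⟩

theorem isOrderedCliqueFree_empty {n : ℕ} (hn : 3 ≤ n) (r : V → V → Prop)
    (hr : IsStrictTotalOrder V r) : IsOrderedCliqueFree n (ordGraphOf r fun _ _ => False) := by
  refine ⟨isOrderedGraph_empty r hr, ?_⟩
  have : SimpleGraph.fromRel (Adj (ordGraphOf r fun _ _ => False)) = ⊥ := by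
    ext a b
    change a ≠ b ∧ (False ∨ False) ↔ False
    simp
  rw [this]
  exact SimpleGraph.cliqueFree_bot (by omega)

theorem isLinearExtension_empty (r : V → V → Prop) (hr : IsStrictTotalOrder V r) :
    IsLinearExtension (ordGraphOf r fun _ _ => False) :=
  ⟨isOrderedGraph_empty r hr,
    { irrefl := fun _ h => h.2
      trans := fun _ _ _ h _ => h.2.elim }⟩

/-! ### Ordered graphs given by equivalence relations -/

section Equivalences

variable {S : ordGraph.Structure ℕ} {G : ordGraph.Structure V}

theorem LocallyEmbedsIn.exists_map [Nonempty V] (h : LocallyEmbedsIn S G) (n : ℕ) :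
    ∃ f : ℕ → V, ∀ i < n, ∀ j < n, (i = j ↔ f i = f j) ∧
      (Lt S i j ↔ Lt G (f i) (f j)) ∧ (Adj S i j ↔ Adj G (f i) (f j)) := by
  obtain ⟨f, hf⟩ := h n
  refine ⟨fun i => if hi : i < n then f ⟨i, hi⟩ else Classical.arbitrary V, fun i hi j hj => ?_⟩
  simp only [hi, hj, dif_pos]
  obtain ⟨h₁, h₂⟩ := hf ⟨i, hi⟩ ⟨j, hj⟩
  exact ⟨⟨fun h => by subst h; rfl, fun h => congrArg Fin.val (h₁ h)⟩, h₂⟩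

theorem LocallyEmbedsIn.isStrictTotalOrder [Nonempty V] (h : LocallyEmbedsIn S G)
    (hG : IsStrictTotalOrder V (Lt G)) : IsStrictTotalOrder ℕ (Lt S) where
  irrefl a ha := by
    obtain ⟨f, hf⟩ := h.exists_map (a + 1)
    exact irrefl_of (Lt G) _ ((hf a (by omega) a (by omega)).2.1.1 ha)
  trans a b c hab hbc := by
    obtain ⟨f, hf⟩ := h.exists_map (a + b + c + 1)
    rw [(hf a (by omega) b (by omega)).2.1] at hab
    rw [(hf b (by omega) c (by omega)).2.1] at hbc
    rw [(hf a (by omega) c (by omega)).2.1]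
    exact trans_of (Lt G) hab hbc
  trichotomous a b hab hba := by
    obtain ⟨f, hf⟩ := h.exists_map (a + b + 1)
    rw [(hf a (by omega) b (by omega)).2.1] at hab
    rw [(hf b (by omega) a (by omega)).2.1] at hba
    rw [(hf a (by omega) b (by omega)).1]
    exact Std.Trichotomous.trichotomous _ _ hab hba

theorem exists_rat_map {α : Type} [Countable α] (r : α → α → Prop) [hr : IsStrictTotalOrder α r] :
    ∃ f : α → ℚ, Function.Injective f ∧ ∀ a b, r a b ↔ f a < f b := by
  classical
  let := linearOrderOfSTO r
  obtain ⟨f⟩ := Order.embedding_from_countable_to_dense (α := α) (β := ℚ)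
  exact ⟨f, f.injective, fun a b => f.lt_iff_lt.symm⟩

theorem isRich_emptyQ : IsRich emptyQ := by
  refine ⟨fun _ h => h, fun S hS => ?_, Or.inl fun r hr => ?_⟩
  · have := hS.isStrictTotalOrder (inferInstanceAs (IsStrictTotalOrder ℚ (· < ·)))
    obtain ⟨f, hf, hlt⟩ := exists_rat_map (Lt S)
    refine embedsIn_iff.2 ⟨f, hf, hlt, fun a b => ?_⟩
    obtain ⟨g, hg⟩ := hS.exists_map (a + b + 1)
    exact (hg a (by omega) b (by omega)).2.2
  · obtain ⟨f, hf, hlt⟩ := exists_rat_map r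
    exact embedsIn_iff.2 ⟨f, hf, hlt, fun _ _ => Iff.rfl⟩

/-- A structure locally embedding into an ordered graph whose adjacency is the equality of the
values of `c` at distinct points carries an equivalence relation with the same property. -/
theorem LocallyEmbedsIn.exists_setoid [Nonempty V] {ι : Type} (h : LocallyEmbedsIn S G)
    {c : V → ι} (hc : ∀ a b, Adj G a b ↔ a ≠ b ∧ c a = c b) :
    ∃ R : Setoid ℕ, (∀ a b, Adj S a b ↔ a ≠ b ∧ R a b) ∧
      ∀ n, ∃ f : ℕ → V, ∀ i < n, ∀ j < n, (Lt S i j ↔ Lt G (f i) (f j)) ∧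
        (R i j ↔ c (f i) = c (f j)) := by
  have key : ∀ n, ∃ f : ℕ → V, ∀ i < n, ∀ j < n, (Lt S i j ↔ Lt G (f i) (f j)) ∧
      ((i = j ∨ Adj S i j) ↔ c (f i) = c (f j)) := fun n => by
    obtain ⟨f, hf⟩ := h.exists_map n
    refine ⟨f, fun i hi j hj => ⟨(hf i hi j hj).2.1, ?_⟩⟩
    rw [(hf i hi j hj).1, (hf i hi j hj).2.2, hc]
    refine ⟨?_, fun h => ?_⟩
    · rintro (h | h)
      · rw [h]
      · exact h.2
    · by_cases h' : f i = f j
      · exact Or.inl h'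
      · exact Or.inr ⟨h', h⟩
  refine ⟨⟨fun a b => a = b ∨ Adj S a b, fun a => Or.inl rfl, fun {a b} hab => ?_,
    fun {a b d} hab hbd => ?_⟩, fun a b => ?_, key⟩
  · obtain ⟨f, hf⟩ := key (a + b + 1)
    exact (hf b (by omega) a (by omega)).2.2 ((hf a (by omega) b (by omega)).2.1 hab).symm
  · obtain ⟨f, hf⟩ := key (a + b + d + 1)
    exact (hf a (by omega) d (by omega)).2.2 (((hf a (by omega) b (by omega)).2.1 hab).trans
      ((hf b (by omega) d (by omega)).2.1 hbd))
  · change Adj S a b ↔ a ≠ b ∧ (a = b ∨ Adj S a b)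
    have hne : Adj S a b → a ≠ b := fun hab => by
      obtain ⟨f, hf⟩ := h.exists_map (a + b + 1)
      rw [(hf a (by omega) b (by omega)).2.2, hc] at hab
      exact (not_congr (hf a (by omega) b (by omega)).1).2 hab.1
    exact ⟨fun h => ⟨hne h, Or.inr h⟩, fun h => h.2.resolve_left h.1⟩

theorem isRich_emptyOfComplete : IsRich emptyOfComplete := by
  have hlin : IsStrictTotalOrder (ℚ × ℚ) (Prod.Lex (· < ·) (· < ·)) :=
    inferInstanceAs (IsStrictTotalOrder (ℚ ×ₗ ℚ) (· < ·))
  refine ⟨fun _ h => h.1 rfl, fun S hS => ?_, Or.inl fun r hr => ?_⟩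
  · have := hS.isStrictTotalOrder hlin
    obtain ⟨g, hg, hlt⟩ := exists_rat_map (Lt S)
    obtain ⟨R, hR, hloc⟩ := hS.exists_setoid (c := Prod.fst) fun _ _ => Iff.rfl
    -- The order of the classes is the order of any representatives.
    let s : ℕ → ℕ := fun a => (Quotient.mk R a).out
    have hs : ∀ a, R (s a) a := fun a => Quotient.mk_out a
    have hsR : ∀ a b, s a = s b ↔ R a b := fun a b =>
      Quotient.out_inj.trans Quotient.eq
    have hslt : ∀ a b, ¬ R a b → (Lt S a b ↔ Lt S (s a) (s b)) := fun a b hab => by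
      obtain ⟨f, hf⟩ := hloc (a + b + s a + s b + 1)
      have h₁ := (hf (s a) (by omega) a (by omega)).2.1 (hs a)
      have h₂ := (hf (s b) (by omega) b (by omega)).2.1 (hs b)
      rw [(hf a (by omega) b (by omega)).2] at hab
      rw [(hf a (by omega) b (by omega)).1, (hf (s a) (by omega) (s b) (by omega)).1]
      change Prod.Lex _ _ (f a) (f b) ↔ Prod.Lex _ _ (f (s a)) (f (s b))
      rw [Prod.lex_def, Prod.lex_def, h₁, h₂]
      simp [hab]
    refine embedsIn_iff.2 ⟨fun a => (g (s a), g a), fun a b h => hg (congrArg Prod.snd h),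
      fun a b => ?_, fun a b => ?_⟩
    · change _ ↔ Prod.Lex _ _ _ _
      rw [Prod.lex_def]
      by_cases hab : R a b
      · simp [(hsR a b).2 hab, hlt]
      · have : g (s a) ≠ g (s b) := hg.ne (mt (hsR a b).1 hab)
        simp [this, hslt a b hab, hlt]
    · change _ ↔ (g (s a), g a) ≠ (g (s b), g b) ∧ g (s a) = g (s b)
      rw [hR, hg.eq_iff, hsR]
      refine and_congr_left fun hab => not_congr ⟨fun h => by rw [h], fun h => ?_⟩
      exact hg (congrArg Prod.snd h)
  · obtain ⟨f, hf, hlt⟩ := exists_rat_map r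
    refine embedsIn_iff.2 ⟨fun a => (f a, 0), fun a b h => hf (congrArg Prod.fst h),
      fun a b => ?_, fun a b => ?_⟩
    · change r a b ↔ Prod.Lex _ _ _ _
      simp [Prod.lex_def, hlt]
    · change False ↔ (f a, (0 : ℚ)) ≠ (f b, 0) ∧ f a = f b
      refine iff_of_false id fun h => h.1 (by rw [h.2])

end Equivalences

/-! ### Shuffled products -/

section Shuffled

variable {ι : Type} {G : ordGraph.Structure V}

theorem isShuffle_of_classes [Nonempty ι] [LinearOrder V] {c : V → ι}
    (h : ∀ i : ι,
      Nonempty (RelIso (fun a b : {v : V // c v = i} => a.1 < b.1) (fun p q : ℚ => p < q)) ∧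
      ∀ a b : V, a < b → ∃ d : V, c d = i ∧ a < d ∧ d < b) : IsShuffle c := by
  have : Nonempty V := by
    obtain ⟨e⟩ := (h (Classical.arbitrary ι)).1
    exact ⟨(e.symm 0).1⟩
  have : NoMinOrder V := ⟨fun a => by
    obtain ⟨e⟩ := (h (c a)).1
    refine ⟨(e.symm (e ⟨a, rfl⟩ - 1)).1, ?_⟩
    exact (e.map_rel_iff (a := e.symm (e ⟨a, rfl⟩ - 1)) (b := ⟨a, rfl⟩)).1 (by simp)⟩
  have : NoMaxOrder V := ⟨fun a => by
    obtain ⟨e⟩ := (h (c a)).1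
    refine ⟨(e.symm (e ⟨a, rfl⟩ + 1)).1, ?_⟩
    exact (e.map_rel_iff (a := ⟨a, rfl⟩) (b := e.symm (e ⟨a, rfl⟩ + 1))).1 (by simp)⟩
  exact .of_dense fun i => (h i).2

/-- A shuffled product is rich, provided that a countable set embeds into the set of its classes as
soon as all finite subsets do. -/
theorem IsShuffled.isRich [Nonempty ι] (hG : IsShuffled ι G)
    (hι : ∀ Q : Type, Countable Q → (∀ n, (Fin n ↪ Q) → Nonempty (Fin n ↪ ι)) →
      Nonempty (Q ↪ ι)) : IsRich G := by
  classical
  obtain ⟨hO, c, hc, hcl⟩ := hG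
  have hlin := hO.linear
  let := linearOrderOfSTO (Lt G)
  have hshuffle : IsShuffle c := isShuffle_of_classes hcl
  have : Nonempty V := by
    obtain ⟨v, -⟩ := hshuffle.surjective (Classical.arbitrary ι)
    exact ⟨v⟩
  have key : ∀ {α : Type} [Countable α] (r : α → α → Prop), IsStrictTotalOrder α r →
      ∀ d : α → ι, EmbedsIn (ordGraphOf r fun a b => a ≠ b ∧ d a = d b) G := by
    intro α _ r hr d
    let := linearOrderOfSTO r
    obtain ⟨f, hf⟩ := hshuffle.exists_orderEmbedding d
    refine embedsIn_iff.2 ⟨f, f.injective, fun a b => f.lt_iff_lt.symm, fun a b => ?_⟩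
    rw [hc, hf, hf, f.injective.ne_iff]
    rfl
  refine ⟨hO.irrefl, fun S hS => ?_, Or.inr fun r hr => ?_⟩
  · have hSlin := hS.isStrictTotalOrder hlin
    obtain ⟨R, hR, hloc⟩ := hS.exists_setoid hc
    obtain ⟨e⟩ := hι (Quotient R) inferInstance fun n g => by
      obtain ⟨N, hN⟩ := (Set.finite_range fun i => (g i).out).bddAbove
      have hlt : ∀ i, (g i).out < N + 1 := fun i => Nat.lt_succ_of_le (hN ⟨i, rfl⟩)
      obtain ⟨f, hf⟩ := hloc (N + 1)
      refine ⟨⟨fun i => c (f (g i).out), fun i j hij => g.injective ?_⟩⟩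
      exact Quotient.out_equiv_out.1 ((hf _ (hlt i) _ (hlt j)).2.2 hij)
    obtain ⟨f, hf⟩ := embedsIn_iff.1 (key (Lt S) hSlin fun a => e (Quotient.mk R a))
    refine embedsIn_iff.2 ⟨f, hf.injective, hf.lt_iff, fun a b => ?_⟩
    rw [← hf.adj_iff, hR]
    change _ ↔ a ≠ b ∧ e (Quotient.mk R a) = e (Quotient.mk R b)
    rw [e.injective.eq_iff, Quotient.eq]
  · have := key r hr fun _ => Classical.arbitrary ι
    simpa using this

theorem nonempty_embedding_fin {k : ℕ} (Q : Type)
    (h : ∀ n, (Fin n ↪ Q) → Nonempty (Fin n ↪ Fin k)) : Nonempty (Q ↪ Fin k) := by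
  cases finite_or_infinite Q with
  | inl hQ =>
    let e := Finite.equivFin Q
    exact (h _ e.symm.toEmbedding).map fun f => e.toEmbedding.trans f
  | inr hQ =>
    obtain ⟨f⟩ := h (k + 1) (Fin.valEmbedding.trans (Infinite.natEmbedding Q))
    exact (by simpa using Fintype.card_le_of_embedding f : False).elim

end Shuffled

theorem IsBasic.isRich [Countable V] {G : ordGraph.Structure V} (h : IsBasic G) : IsRich G := by
  cases h with
  | orderedLinearOrder h =>
    exact h.isRich_of_complete (fun _ hS => hS.1) isOrderedLinearOrder_complete
  | orderedLocalOrder h =>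
    exact h.isRich_of_complete (fun _ hS => hS.1) isOrderedLocalOrder_complete
  | orderedGraph h => exact h.isRich_of_empty (fun _ hS => hS) isOrderedGraph_empty
  | cliqueFree n hn h =>
    exact h.isRich_of_empty (fun _ hS => hS.1) (isOrderedCliqueFree_empty hn)
  | linearExtension h => exact h.isRich_of_empty (fun _ hS => hS.1) isLinearExtension_empty
  | empty h => exact isRich_emptyQ.of_isomorphic h
  | emptyOfComplete h => exact isRich_emptyOfComplete.of_isomorphic h
  | shuffledFinite n hn h =>
    have : Nonempty (Fin n) := ⟨⟨0, hn⟩⟩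
    exact h.isRich fun Q _ => nonempty_embedding_fin Q
  | shuffledInfinite h => exact h.isRich fun Q _ _ =>
    let ⟨f, hf⟩ := exists_injective_nat Q
    ⟨⟨f, hf⟩⟩

end RichOrderedGraphs

end OrderedGraphs

theorem mainTheorem2 (V : Type) [Countable V] (G : OrderedGraphs.ordGraph.Structure V)
    (hG : OrderedGraphs.InCherlinList G) :
    OrderedGraphs.BorelComplete (OrderedGraphs.countableSubstructures G) := by
  obtain ⟨T, hT, rfl | rfl⟩ := hG
  · exact hT.isRich.borelComplete
  · exact hT.isRich.complement.borelComplete
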